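/- Let $\varphi:[0,\infty)\to\mathbb R$ be increasing with $\lim_{x\to\infty}\varphi(x)=\infty$, such that $\varphi(z):=\varphi(|z|)$ is $C^2$ on $\mathbb C$ with $\Delta\varphi>0$ (in particular, it is subharmonic). Put $\rho(z)=(\Delta\varphi(z))^{-1/2}$, and assume that for every fixed $C>0$ one has $\rho(x+C\rho(x))\asymp\rho(x)$, $0<x<\infty$. (Here $A\asymp B$ means that $A\le KB$ and $B\le KA$ with a constant $K$ independent of the variable.) For a weight $\psi$ on $[0,\infty)$ and a measurable function $g$ on $\mathbb C$, write $\|g\|_\psi^2=\int_{\mathbb C}|g(z)|^2e^{-2\psi(|z|)}\,dm(z)$ with $m$ the area measure, and let $\mathcal F^2_\varphi$ be the space of entire functions $f$ with $\|f\|_\varphi<\infty$. For $\gamma\in\mathbb R$, let $\mathcal S_\gamma$ be the class of entire functions $S$ with zero set $\Lambda$ such that (1) $\Lambda$ is $d_\rho$-separated, that is, $\inf\{|\lambda-\lambda^*|/\min(\rho(\lambda),\rho(\lambda^*)) : \lambda,\lambda^*\in\Lambda,\ \lambda\ne\lambda^*\}>0$; (2) $|S(z)|\asymp e^{\varphi(z)}\,\dfrac{d(z,\Lambda)}{\rho(z)}\,\dfrac{1}{(1+|z|)^{\gamma}}$,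 $z\in\mathbb C$, where $d(z,\Lambda)$ is the Euclidean distance from $z$ to $\Lambda$. Theorem. Let $0\le\beta\le1$, $\gamma+\beta\in(1/2,1)$, and $S\in\mathcal S_\gamma$, and let $(\lambda_k)_{k\ge1}$ be the zeros of $S$, each listed once, ordered so that $|\lambda_k|\le|\lambda_{k+1}|$. Suppose that $r^{1-2\beta}=O(\rho(r))$ as $r\to+\infty$. Then for every $f\in\mathcal F^2_\varphi$, $$\lim_{N\to\infty}\Bigl\|f-S\sum_{k=1}^{N}\frac{f(\lambda_k)}{S'(\lambda_k)(\cdot-\lambda_k)}\Bigr\|_{\varphi_\beta}=0,\qquad \varphi_\beta(r)=\varphi(r)+\beta\log(1+r).$$ -/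

import Mathlib

open Filter Asymptotics MeasureTheory
open scoped ENNReal Topology Laplacian

/-- `u ≍ v` on the set `s`: each of the two functions is bounded by a constant times the other. -/
def ComparableOn {α : Type*} (s : Set α) (u v : α → ℝ) : Prop :=
  ∃ K : ℝ, 0 < K ∧ ∀ x ∈ s, u x ≤ K * v x ∧ v x ≤ K * u x

/-- The function `ρ = (Δφ)^(-1/2)` on the plane, where `φ` is regarded as the radial function
`z ↦ φ(|z|)`. -/
noncomputable def rho (φ : ℝ → ℝ) (z : ℂ) : ℝ :=
  (Laplacian.laplacian (fun w : ℂ => φ ‖w‖) z) ^ (-(1 / 2) : ℝ)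

/-- The standing assumptions on a weight `φ`; only its values on `[0, ∞)` are used. -/
structure IsFockWeight (φ : ℝ → ℝ) : Prop where
  /-- `φ` is increasing on `[0, ∞)`. -/
  monotoneOn : MonotoneOn φ (Set.Ici 0)
  /-- `φ(x) → ∞` as `x → ∞`. -/
  tendsto_atTop : Tendsto φ atTop atTop
  /-- `z ↦ φ(|z|)` is `C²` on the plane (regarded as a real vector space). -/
  contDiff : ContDiff ℝ 2 (fun z : ℂ => φ ‖z‖)
  /-- `Δφ > 0`: subharmonicity of the `C²` function `z ↦ φ(|z|)` is `Δφ ≥ 0`, and `Δφ` does not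
  vanish because `ρ = (Δφ)^(-1/2)` is a finite function on the plane. -/
  laplacian_pos : ∀ z : ℂ, 0 < Laplacian.laplacian (fun w : ℂ => φ ‖w‖) z
  /-- For every fixed `C > 0`: `ρ(x + C ρ(x)) ≍ ρ(x)`, `0 < x < ∞`. -/
  rho_comparable : ∀ C : ℝ, 0 < C →
    ComparableOn (Set.Ioi (0 : ℝ))
      (fun x => rho φ ((x + C * rho φ (x : ℂ) : ℝ) : ℂ)) (fun x => rho φ (x : ℂ))

/-- The norm `‖f‖_φ = (∫ |f(z)|² exp(-2 φ(|z|)) dm(z))^(1/2)`, with values in `[0, ∞]`,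
where `m` is area measure. -/
noncomputable def fockNorm (φ : ℝ → ℝ) (f : ℂ → ℂ) : ℝ≥0∞ :=
  (∫⁻ z : ℂ, ENNReal.ofReal (‖f z‖ ^ 2 * Real.exp (-2 * φ ‖z‖))) ^ (1 / 2 : ℝ)

/-- The weighted Fock space: entire functions with finite norm. -/
def FockSpace (φ : ℝ → ℝ) : Set (ℂ → ℂ) :=
  {f | Differentiable ℂ f ∧ fockNorm φ f < ∞}

/-- `d_ρ(z, w) = |z - w| / min(ρ(z), ρ(w))`. -/
noncomputable def dRho (φ : ℝ → ℝ) (z w : ℂ) : ℝ :=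
  ‖z - w‖ / min (rho φ z) (rho φ w)

/-- `d_ρ`-separated sets: the infimum of `d_ρ` over pairs of distinct points is positive. -/
def IsDRhoSeparated (φ : ℝ → ℝ) (Λ : Set ℂ) : Prop :=
  ∃ c : ℝ, 0 < c ∧ ∀ z ∈ Λ, ∀ w ∈ Λ, z ≠ w → c ≤ dRho φ z w

/-- The zero set of a function. -/
def zeroSet (S : ℂ → ℂ) : Set ℂ := {z | S z = 0}

/-- The class `𝒮_γ`: entire functions with `d_ρ`-separated zero set `Λ` such that
`|S(z)| ≍ e^{φ(z)} (d(z, Λ) / ρ(z)) (1 + |z|)^{-γ}` on the plane. -/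
structure InClassS (φ : ℝ → ℝ) (γ : ℝ) (S : ℂ → ℂ) : Prop where
  /-- `S` is entire. -/
  entire : Differentiable ℂ S
  /-- The zero set is `d_ρ`-separated. -/
  separated : IsDRhoSeparated φ (zeroSet S)
  /-- The two-sided estimate. -/
  comparable : ComparableOn Set.univ (fun z : ℂ => ‖S z‖)
    (fun z : ℂ => Real.exp (φ ‖z‖) * (Metric.infDist z (zeroSet S) / rho φ z)
      * (1 / (1 + ‖z‖) ^ γ))

/-- `lam` lists the points of `Λ`, each exactly once, by non-decreasing modulus. -/
structure IsOrderedEnumeration (Λ : Set ℂ) (lam : ℕ → ℂ) : Prop where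
  /-- No point is listed twice. -/
  injective : Function.Injective lam
  /-- Exactly the points of `Λ` are listed. -/
  range_eq : Set.range lam = Λ
  /-- The moduli are non-decreasing. -/
  monotone_norm : Monotone (fun k => ‖lam k‖)

/-- The partial sum, over the first `N` points, of the Lagrange interpolation series of `f`.
At the finitely many points `lam k` with `k < N`, which are removable singularities, the value of
this formula is irrelevant for the norm, an area integral. -/
noncomputable def lagrangePartialSum (S : ℂ → ℂ) (lam : ℕ → ℂ) (f : ℂ → ℂ) (N : ℕ) (z : ℂ) : ℂ :=
  S z * ∑ k ∈ Finset.range N, f (lam k) / (deriv S (lam k) * (z - lam k))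

/-- The modified weight `φ_β(r) = φ(r) + β log(1 + r)`. -/
noncomputable def modifiedWeight (φ : ℝ → ℝ) (β : ℝ) (r : ℝ) : ℝ :=
  φ r + β * Real.log (1 + r)

/-!
Let `R = |λ_N|` and let `χ` be a cutoff at radius `R` that equals `1` near the first `N` zeros and
`0` near all others, with gradient `O(1 / ρ(R))` supported in an annulus of width `O(ρ(R))` and away
from the zeros (`InClassS.exists_adapted_cutoff`). The function
`G = χ f / S - ∑_{k < N} f(λ_k) / (S'(λ_k) (z - λ_k))`
is smooth, tends to `0` at infinity and satisfies `∂̄G = (f / S) ∂̄χ`, and the remainder of the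
interpolation series is `(1 - χ) f + S G` (`exists_remainder`). The norm of the first summand is at
most a tail of the norm of `f`.

As to the second, `|S|² e^{-2φ_β}` is at most a constant times `(1 + |z|)^{-2(γ + β)}`, so a weighted
`L²` bound for `G` in terms of `∂̄G` is needed (`lintegral_sq_mul_weight_le`). The Fourier
coefficients of `G` on circles solve first order linear equations in the logarithm of the radius,
which are integrated from infinity for the nonnegative frequencies and from the origin for the negative
ones; Parseval's identity sums up the resulting bounds. Since `∂̄G` lives on a thin annulus, the
outcome is a bound by `R^(1 - 2β) / ρ(R)` times a tail of the norm of `f`, and the hypothesis on `ρ`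
says that the first factor is bounded. The cutoff, rather than a contour, lets every partial sum be
treated, whatever the position of the zeros.

Two facts about the weight and the zeros enter. The function `ρ` is slowly varying
(`exists_slowlyVarying`); as the hypothesis has a constant for each `C` separately, this uses Baire's
theorem. And the distance from `z` to the zero set is `O(ρ(z))` (`InClassS.exists_infDist_le`), by a
maximum principle for the subharmonic function `φ - log |S|` on zero-free discs.
-/

/-! ### Fourier coefficients on circles -/

/-- The `n`-th Fourier coefficient of `G` on the circle of radius `e ^ u`; the logarithm of the
radius is the variable, so that rectangles in the `exp`-chart are annuli. -/
noncomputable def circleCoeff (G : ℂ → ℂ) (n : ℤ) (u : ℝ) : ℂ :=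
  fourierCoeffOn (neg_lt_self Real.pi_pos) (fun y : ℝ => G (Complex.exp (u + y * Complex.I))) n

lemma circleCoeff_eq (G : ℂ → ℂ) (n : ℤ) (u : ℝ) :
    circleCoeff G n u = (1 / (2 * Real.pi) : ℂ) * ∫ y in -Real.pi..Real.pi,
      Complex.exp (-n * (y * Complex.I)) * G (Complex.exp (u + y * Complex.I)) := by
  rw [circleCoeff, fourierCoeffOn_eq_integral]
  have h : (Real.pi - -Real.pi) = 2 * Real.pi := by ring
  rw [Complex.real_smul]
  congr 1
  · rw [h]; push_cast; rfl
  · refine intervalIntegral.integral_congr fun y _ => ?_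
    simp only [fourier_coe_apply, smul_eq_mul]
    congr 2
    have hpi : (Real.pi : ℂ) ≠ 0 := by exact_mod_cast Real.pi_ne_zero
    push_cast
    field_simp
    ring

lemma exp_mul_circleCoeff (G : ℂ → ℂ) (n : ℤ) (u : ℝ) :
    Complex.exp (-n * u) * circleCoeff G n u = (1 / (2 * Real.pi) : ℂ) *
      ∫ y in -Real.pi..Real.pi,
      G (Complex.exp (u + y * Complex.I)) * Complex.exp (-n * (u + y * Complex.I)) := by
  rw [circleCoeff_eq, mul_left_comm, ← intervalIntegral.integral_const_mul]
  congr 1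
  refine intervalIntegral.integral_congr fun y _ => ?_
  simp only [mul_add, Complex.exp_add]
  ring

lemma continuous_circleCoeff {G : ℂ → ℂ} (hG : Continuous G) (n : ℤ) :
    Continuous (circleCoeff G n) := by
  rw [funext (circleCoeff_eq G n)]
  refine continuous_const.mul ?_
  refine intervalIntegral.continuous_parametric_intervalIntegral_of_continuous' ?_ _ _
  fun_prop

lemma norm_circleCoeff_le {G : ℂ → ℂ} (n : ℤ) {u C : ℝ}
    (hC : ∀ z : ℂ, ‖z‖ = Real.exp u → ‖G z‖ ≤ C) : ‖circleCoeff G n u‖ ≤ C := by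
  have hpi := Real.pi_pos
  have h := intervalIntegral.norm_integral_le_of_norm_le_const (a := -Real.pi) (b := Real.pi)
    (C := C) (f := fun y : ℝ =>
      Complex.exp (-n * (y * Complex.I)) * G (Complex.exp (u + y * Complex.I))) (fun y _ => by
        rw [norm_mul]
        have h1 : ‖Complex.exp (-n * (y * Complex.I))‖ = 1 := by
          rw [Complex.norm_exp]; simp
        rw [h1, one_mul]
        exact hC _ (by rw [Complex.norm_exp]; simp))
  rw [circleCoeff_eq, norm_mul]
  have h2 : ‖(1 / (2 * Real.pi) : ℂ)‖ = 1 / (2 * Real.pi) := by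
    rw [norm_div, norm_mul]; simp [abs_of_pos hpi]
  rw [h2]
  have h3 : |Real.pi - -Real.pi| = 2 * Real.pi := by rw [abs_of_pos] <;> linarith
  rw [h3] at h
  calc _ ≤ 1 / (2 * Real.pi) * (C * (2 * Real.pi)) := by gcongr
    _ = C := by field_simp

lemma hasSum_sq_circleCoeff {G : ℂ → ℂ} (hG : Continuous G) (u : ℝ) :
    HasSum (fun n => ‖circleCoeff G n u‖ ^ 2)
      ((2 * Real.pi)⁻¹ * ∫ y in -Real.pi..Real.pi, ‖G (Complex.exp (u + y * Complex.I))‖ ^ 2) := by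
  have hc : Continuous fun y : ℝ => G (Complex.exp (u + y * Complex.I)) := by fun_prop
  have h := hasSum_sq_fourierCoeffOn (neg_lt_self Real.pi_pos)
    (f := fun y : ℝ => G (Complex.exp (u + y * Complex.I))) (by
      obtain ⟨C, hC⟩ := (isCompact_Icc (a := -Real.pi) (b := Real.pi)).exists_bound_of_continuousOn
        hc.continuousOn
      refine MemLp.of_bound hc.aestronglyMeasurable C ?_
      filter_upwards [ae_restrict_mem measurableSet_Ioc] with y hy
      exact hC y (Set.Ioc_subset_Icc_self hy))
  have e : (Real.pi - -Real.pi) = 2 * Real.pi := by ring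
  rw [e, smul_eq_mul] at h
  exact h

/-- `2 i z̄ ∂G/∂z̄`, written with the real derivative. This is the combination that Green's formula
produces in the coordinate `log z`. -/
noncomputable def dbarTwist (G : ℂ → ℂ) (z : ℂ) : ℂ :=
  Complex.I * fderiv ℝ G z z - fderiv ℝ G z (Complex.I * z)

lemma continuous_dbarTwist {G : ℂ → ℂ} (hG : ContDiff ℝ 1 G) : Continuous (dbarTwist G) := by
  have := hG.continuous_fderiv one_ne_zero
  unfold dbarTwist
  fun_prop

/-- Green's formula for `G(e^w) e^{-nw}` on a rectangle of height `2π`: the horizontal sides cancel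
by periodicity. -/
lemma exp_mul_circleCoeff_sub {G : ℂ → ℂ} (hG : ContDiff ℝ 1 G) (n : ℤ) (u v : ℝ) :
    Complex.exp (-n * v) * circleCoeff G n v - Complex.exp (-n * u) * circleCoeff G n u =
      -Complex.I * ∫ s in u..v, Complex.exp (-n * s) * circleCoeff (dbarTwist G) n s := by
  have hd : ∀ w : ℂ, HasFDerivAt (𝕜 := ℝ) (fun w : ℂ => G (Complex.exp w) * Complex.exp (-n * w))
      (G (Complex.exp w) • ((-n * Complex.exp (-n * w)) • (1 : ℂ →L[ℝ] ℂ)) +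
        Complex.exp (-n * w) • ((fderiv ℝ G (Complex.exp w)).comp
          (Complex.exp w • (1 : ℂ →L[ℝ] ℂ)))) w := by
    intro w
    have h1 : HasFDerivAt (𝕜 := ℝ) Complex.exp (Complex.exp w • (1 : ℂ →L[ℝ] ℂ)) w :=
      (Complex.hasDerivAt_exp w).complexToReal_fderiv
    have h2 : HasFDerivAt (𝕜 := ℝ) (fun w : ℂ => Complex.exp (-n * w))
        ((-n * Complex.exp (-n * w)) • (1 : ℂ →L[ℝ] ℂ)) w := by
      apply HasDerivAt.complexToReal_fderiv
      have := ((hasDerivAt_id w).const_mul (-n : ℂ)).cexp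
      simpa [mul_comm] using this
    exact (((hG.differentiable one_ne_zero) _).hasFDerivAt.comp w h1).mul h2
  have key : ∀ w : ℂ,
      Complex.I • (fderiv ℝ (fun w : ℂ => G (Complex.exp w) * Complex.exp (-n * w)) w 1) -
        fderiv ℝ (fun w : ℂ => G (Complex.exp w) * Complex.exp (-n * w)) w Complex.I =
      dbarTwist G (Complex.exp w) * Complex.exp (-n * w) := by
    intro w
    rw [(hd w).fderiv]
    simp [dbarTwist, mul_comm Complex.I (Complex.exp w)]
    ring
  have hcont : Continuous (fun w : ℂ => dbarTwist G (Complex.exp w) * Complex.exp (-n * w)) := by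
    have := continuous_dbarTwist hG
    fun_prop
  have h := Complex.integral_boundary_rect_of_differentiableOn_real
    (fun w : ℂ => G (Complex.exp w) * Complex.exp (-n * w))
    (u + (-Real.pi : ℝ) * Complex.I) (v + Real.pi * Complex.I)
    (fun w _ => (hd w).differentiableAt.differentiableWithinAt)
    (by
      simp only [key]
      refine hcont.continuousOn.integrableOn_compact ?_
      exact isCompact_uIcc.reProdIm isCompact_uIcc)
  simp only [key] at h
  simp only [Complex.add_re, Complex.ofReal_re, Complex.mul_re, Complex.I_re, mul_zero,
    Complex.ofReal_im, Complex.I_im, sub_self, add_zero, Complex.add_im, Complex.mul_im,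
    mul_one, zero_add] at h
  have hper : (∫ x in u..v, G (Complex.exp (x + (-Real.pi : ℝ) * Complex.I)) *
        Complex.exp (-n * (x + (-Real.pi : ℝ) * Complex.I))) =
      ∫ x in u..v, G (Complex.exp (x + Real.pi * Complex.I)) *
        Complex.exp (-n * (x + Real.pi * Complex.I)) := by
    refine intervalIntegral.integral_congr fun x _ => ?_
    have e1 : Complex.exp (x + (-Real.pi : ℝ) * Complex.I) =
        Complex.exp (x + Real.pi * Complex.I) := by
      rw [Complex.exp_eq_exp_iff_exists_int]
      exact ⟨-1, by push_cast; ring⟩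
    have e2 : Complex.exp (-n * (x + (-Real.pi : ℝ) * Complex.I)) =
        Complex.exp (-n * (x + Real.pi * Complex.I)) := by
      rw [Complex.exp_eq_exp_iff_exists_int]
      exact ⟨n, by push_cast; ring⟩
    simp only [e1, e2]
  rw [hper, sub_self, zero_add] at h
  have hrw : ∀ s : ℝ, Complex.exp (-n * s) * circleCoeff (dbarTwist G) n s = _ :=
    exp_mul_circleCoeff (dbarTwist G) n
  simp only [hrw, exp_mul_circleCoeff]
  rw [intervalIntegral.integral_const_mul, ← h]
  simp only [smul_eq_mul]
  linear_combination (1 / (2 * Real.pi) : ℂ) *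
    ((∫ y in -Real.pi..Real.pi,
        G (Complex.exp (v + y * Complex.I)) * Complex.exp (-n * (v + y * Complex.I))) -
      (∫ y in -Real.pi..Real.pi,
        G (Complex.exp (u + y * Complex.I)) * Complex.exp (-n * (u + y * Complex.I)))) *
      Complex.I_mul_I

/-- The Cauchy–Schwarz inequality against the constant function `1`. -/
lemma sq_integral_le {g : ℝ → ℝ} (hg : Continuous g) {α β : ℝ} (hαβ : α ≤ β) :
    (∫ s in α..β, g s) ^ 2 ≤ (β - α) * ∫ s in α..β, g s ^ 2 := by
  rcases hαβ.eq_or_lt with rfl | hlt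
  · simp
  have hL : 0 < β - α := sub_pos.2 hlt
  set J := ∫ s in α..β, g s with hJ
  have h0 : 0 ≤ ∫ s in α..β, (g s - J / (β - α)) ^ 2 :=
    intervalIntegral.integral_nonneg hαβ fun s _ => sq_nonneg _
  have h1 : ∫ s in α..β, (g s - J / (β - α)) ^ 2 =
      (∫ s in α..β, g s ^ 2) - J ^ 2 / (β - α) := by
    have e : ∀ s, (g s - J / (β - α)) ^ 2 =
        g s ^ 2 - (2 * (J / (β - α)) * g s - (J / (β - α)) ^ 2) := fun s => by ring
    simp only [e]
    rw [intervalIntegral.integral_sub, intervalIntegral.integral_sub,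
      intervalIntegral.integral_const_mul, ← hJ, intervalIntegral.integral_const, smul_eq_mul]
    · field_simp; ring
    all_goals exact Continuous.intervalIntegrable (by fun_prop) _ _
  rw [h1, sub_nonneg, div_le_iff₀ hL] at h0
  linarith

/-- A function vanishing at infinity is controlled, one Fourier mode at a time, by its
antiholomorphic derivative, with the decay of `1 / z` outside the support of the latter. -/
lemma norm_circleCoeff_le_integral {G : ℂ → ℂ} (hG : ContDiff ℝ 1 G)
    (hinf : Tendsto G (cocompact ℂ) (𝓝 0)) {α β : ℝ} (hαβ : α ≤ β)
    (hsupp : ∀ z : ℂ, ‖z‖ ∉ Set.Icc (Real.exp α) (Real.exp β) → dbarTwist G z = 0)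
    (n : ℤ) (u : ℝ) :
    ‖circleCoeff G n u‖ ≤ min 1 (Real.exp (β - u)) *
      ∫ s in α..β, ‖circleCoeff (dbarTwist G) n s‖ := by
  set h := circleCoeff (dbarTwist G) n with hh
  have hhc : Continuous h := continuous_circleCoeff (continuous_dbarTwist hG) n
  have hh0 : ∀ s, s ∉ Set.Icc α β → h s = 0 := by
    intro s hs
    have : ‖h s‖ ≤ 0 := norm_circleCoeff_le n fun z hz => by
      rw [hsupp z, norm_zero]
      rw [hz, Set.mem_Icc, Real.exp_le_exp, Real.exp_le_exp]
      exact hs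
    exact norm_le_zero_iff.1 this
  set J := ∫ s in α..β, ‖h s‖ with hJ
  set m := min 1 (Real.exp (β - u)) with hm
  have hm0 : 0 ≤ m := le_min zero_le_one (Real.exp_pos _).le
  have hint : Integrable (fun s => ‖h s‖) := by
    have : HasCompactSupport h := HasCompactSupport.intro isCompact_Icc hh0
    exact (hhc.integrable_of_hasCompactSupport this).norm
  have hJeq : ∫ s, ‖h s‖ = J := by
    rw [hJ, intervalIntegral.integral_of_le hαβ, ← integral_Icc_eq_integral_Ioc,
      setIntegral_eq_integral_of_forall_compl_eq_zero]
    intro s hs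
    rw [hh0 s hs, norm_zero]
  have hJle : ∀ p q : ℝ, p ≤ q → ∫ s in p..q, ‖h s‖ ≤ J := by
    intro p q hpq
    rw [intervalIntegral.integral_of_le hpq, ← hJeq]
    exact setIntegral_le_integral hint (Eventually.of_forall fun _ => norm_nonneg _)
  -- transport from the circle of radius `e ^ v` to the one of radius `e ^ u`
  have hrel : ∀ v : ℝ, ‖circleCoeff G n u‖ ≤ Real.exp (n * (u - v)) * ‖circleCoeff G n v‖ +
      ‖∫ s in u..v, Complex.exp (n * (u - s)) * h s‖ := by
    intro v
    have h1 := exp_mul_circleCoeff_sub hG n u v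
    have h2 : circleCoeff G n u = Complex.exp (n * (u - v)) * circleCoeff G n v +
        Complex.I * ∫ s in u..v, Complex.exp (n * (u - s)) * h s := by
      have h3 : ∫ s in u..v, Complex.exp (n * (u - s)) * h s =
          Complex.exp (n * u) * ∫ s in u..v, Complex.exp (-n * s) * h s := by
        rw [← intervalIntegral.integral_const_mul]
        refine intervalIntegral.integral_congr fun s _ => ?_
        simp only [← mul_assoc, ← Complex.exp_add]
        ring_nf
      have h4 : Complex.exp (n * (u - v)) = Complex.exp (n * u) * Complex.exp (-n * v) := by
        rw [← Complex.exp_add]; ring_nf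
      have h5 : Complex.exp (n * u) * Complex.exp (-n * u) = 1 := by
        rw [← Complex.exp_add]; simp
      rw [h3, h4]
      linear_combination (-Complex.exp (n * u)) * h1 - circleCoeff G n u * h5
    rw [h2]
    refine (norm_add_le _ _).trans ?_
    rw [norm_mul, norm_mul, Complex.norm_I, one_mul, Complex.norm_exp]
    simp
  -- the boundary term vanishes as `v → ∞` if `0 ≤ n` (decay of `G`) and as `v → -∞` if `n < 0`
  -- (boundedness of `G` near the origin)
  have hzero : ∀ ε > 0, ∃ v : ℝ, Real.exp (n * (u - v)) * ‖circleCoeff G n v‖ ≤ ε ∧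
      ((0 ≤ n ∧ u ≤ v) ∨ (n < 0 ∧ v ≤ u)) := by
    intro ε hε
    rcases le_or_gt 0 n with hn | hn
    · have hev : ∀ᶠ z in cocompact ℂ, ‖G z‖ ≤ ε := by
        have := (tendsto_zero_iff_norm_tendsto_zero.1 hinf).eventually (Iic_mem_nhds hε)
        exact this
      rw [← Metric.cobounded_eq_cocompact, ← comap_norm_atTop, eventually_comap] at hev
      obtain ⟨v, hv1, hv2⟩ :=
        ((Real.tendsto_exp_atTop.eventually hev).and (eventually_ge_atTop u)).exists
      refine ⟨v, ?_, Or.inl ⟨hn, hv2⟩⟩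
      have b1 := norm_circleCoeff_le (G := G) n (u := v) (C := ε) fun z hz => hv1 z hz
      have b2 : Real.exp (n * (u - v)) ≤ 1 := by
        rw [Real.exp_le_one_iff]
        have : (0 : ℝ) ≤ n := by exact_mod_cast hn
        nlinarith
      calc _ ≤ 1 * ε := by gcongr
        _ = ε := one_mul ε
    · obtain ⟨C, hC⟩ := (isCompact_closedBall (0 : ℂ) (Real.exp u)).exists_bound_of_continuousOn
        hG.continuous.continuousOn
      have hCn : 0 ≤ C := (norm_nonneg _).trans (hC 0 (by simp [Real.exp_nonneg]))
      have ht : Tendsto (fun v : ℝ => Real.exp (v - u) * C) atBot (𝓝 (0 * C)) := by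
        refine Tendsto.mul_const _ (Real.tendsto_exp_atBot.comp ?_)
        exact tendsto_atBot_add_const_right _ (-u) tendsto_id
      rw [zero_mul] at ht
      obtain ⟨v, hv1, hv2⟩ := ((ht.eventually (Iic_mem_nhds hε)).and
        (eventually_le_atBot u)).exists
      refine ⟨v, le_trans ?_ hv1, Or.inr ⟨hn, hv2⟩⟩
      have b1 := norm_circleCoeff_le (G := G) n (u := v) (C := C) fun z hz =>
        hC z (by simpa [hz] using hv2)
      have b2 : (n : ℝ) * (u - v) ≤ v - u := by
        have : (n : ℝ) ≤ -1 := by exact_mod_cast Int.le_sub_one_of_lt hn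
        nlinarith
      gcongr
  -- in both directions the integrand is damped; outside the annulus (`β < u`) only `n ≤ -1`
  -- contributes, which gives the factor `e ^ (β - u)`
  have hbound : ∀ v : ℝ, ((0 ≤ n ∧ u ≤ v) ∨ (n < 0 ∧ v ≤ u)) →
      ‖∫ s in u..v, Complex.exp (n * (u - s)) * h s‖ ≤ m * J := by
    intro v hv
    have hpt : ∀ s, ((0 ≤ n ∧ u ≤ s) ∨ (n < 0 ∧ s ≤ u)) →
        ‖Complex.exp (n * (u - s)) * h s‖ ≤ m * ‖h s‖ := by
      intro s hs
      rw [norm_mul]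
      by_cases hsβ : s ∈ Set.Icc α β
      swap
      · simp [hh0 s hsβ]
      refine mul_le_mul_of_nonneg_right ?_ (norm_nonneg _)
      rw [Complex.norm_exp]
      have e : ((n : ℂ) * (u - s)).re = n * (u - s) := by simp
      rw [e, hm]
      rcases hs with ⟨hn, hus⟩ | ⟨hn, hsu⟩
      · have hn' : (0 : ℝ) ≤ n := by exact_mod_cast hn
        have hle : (n : ℝ) * (u - s) ≤ 0 := by nlinarith
        refine le_min (Real.exp_le_one_iff.2 hle) (Real.exp_le_exp.2 ?_)
        linarith [hsβ.2]
      · have hn' : (n : ℝ) ≤ -1 := by exact_mod_cast Int.le_sub_one_of_lt hn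
        have hle : (n : ℝ) * (u - s) ≤ -(u - s) := by nlinarith
        refine le_min (Real.exp_le_one_iff.2 (by linarith)) (Real.exp_le_exp.2 ?_)
        linarith [hsβ.2]
    rcases hv with ⟨hn, huv⟩ | ⟨hn, hvu⟩
    · calc _ ≤ ∫ s in u..v, m * ‖h s‖ :=
          intervalIntegral.norm_integral_le_of_norm_le huv
            (Eventually.of_forall fun s hs => hpt s (Or.inl ⟨hn, hs.1.le⟩))
            (Continuous.intervalIntegrable (by fun_prop) _ _)
        _ = m * ∫ s in u..v, ‖h s‖ := intervalIntegral.integral_const_mul _ _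
        _ ≤ m * J := by gcongr; exact hJle _ _ huv
    · rw [intervalIntegral.integral_symm, norm_neg]
      calc _ ≤ ∫ s in v..u, m * ‖h s‖ :=
          intervalIntegral.norm_integral_le_of_norm_le hvu
            (Eventually.of_forall fun s hs => hpt s (Or.inr ⟨hn, hs.2⟩))
            (Continuous.intervalIntegrable (by fun_prop) _ _)
        _ = m * ∫ s in v..u, ‖h s‖ := intervalIntegral.integral_const_mul _ _
        _ ≤ m * J := by gcongr; exact hJle _ _ hvu
  refine le_of_forall_pos_le_add fun ε hε => ?_
  obtain ⟨v, hv1, hv2⟩ := hzero ε hε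
  have := hrel v
  have := hbound v hv2
  linarith

/-- The `L²` bound on circles that results from summing the mode-by-mode bound by Parseval. -/
theorem integral_sq_circle_le {G : ℂ → ℂ} (hG : ContDiff ℝ 1 G)
    (hinf : Tendsto G (cocompact ℂ) (𝓝 0)) {α β : ℝ} (hαβ : α ≤ β)
    (hsupp : ∀ z : ℂ, ‖z‖ ∉ Set.Icc (Real.exp α) (Real.exp β) → dbarTwist G z = 0) (u : ℝ) :
    ∫ y in -Real.pi..Real.pi, ‖G (Complex.exp (u + y * Complex.I))‖ ^ 2 ≤
      min 1 (Real.exp (β - u)) ^ 2 * ((β - α) * ∫ s in α..β, ∫ y in -Real.pi..Real.pi,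
        ‖dbarTwist G (Complex.exp (s + y * Complex.I))‖ ^ 2) := by
  have hD := continuous_dbarTwist hG
  set m := min 1 (Real.exp (β - u)) with hm
  have hpi := Real.pi_pos
  have hsum := hasSum_sq_circleCoeff hG.continuous u
  have hcI : Continuous fun s : ℝ => ∫ y in -Real.pi..Real.pi,
        ‖dbarTwist G (Complex.exp (s + y * Complex.I))‖ ^ 2 := by
    refine intervalIntegral.continuous_parametric_intervalIntegral_of_continuous' ?_ _ _
    fun_prop
  have hfin : ∀ F : Finset ℤ, ∑ n ∈ F, ‖circleCoeff G n u‖ ^ 2 ≤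
      m ^ 2 * ((β - α) * ∫ s in α..β, (2 * Real.pi)⁻¹ * ∫ y in -Real.pi..Real.pi,
        ‖dbarTwist G (Complex.exp (s + y * Complex.I))‖ ^ 2) := by
    intro F
    have hterm : ∀ n ∈ F, ‖circleCoeff G n u‖ ^ 2 ≤ m ^ 2 * ((β - α) *
        ∫ s in α..β, ‖circleCoeff (dbarTwist G) n s‖ ^ 2) := by
      intro n _
      have h1 := norm_circleCoeff_le_integral hG hinf hαβ hsupp n u
      calc _ ≤ (m * ∫ s in α..β, ‖circleCoeff (dbarTwist G) n s‖) ^ 2 := by gcongr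
        _ = m ^ 2 * (∫ s in α..β, ‖circleCoeff (dbarTwist G) n s‖) ^ 2 := by ring
        _ ≤ _ := by
          gcongr
          exact sq_integral_le (continuous_circleCoeff hD n).norm hαβ
    refine (Finset.sum_le_sum hterm).trans ?_
    rw [← Finset.mul_sum, ← Finset.mul_sum, ← intervalIntegral.integral_finsetSum]
    · have : 0 ≤ β - α := sub_nonneg.2 hαβ
      gcongr
      refine intervalIntegral.integral_mono_on hαβ ?_ ?_ fun s _ => ?_
      · refine Continuous.intervalIntegrable ?_ _ _
        exact continuous_finsetSum _ fun n _ => (continuous_circleCoeff hD n).norm.pow 2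
      · exact (continuous_const.mul hcI).intervalIntegrable _ _
      · exact sum_le_hasSum F (fun _ _ => sq_nonneg _) (hasSum_sq_circleCoeff hD s)
    · intro n _
      exact ((continuous_circleCoeff hD n).norm.pow 2).intervalIntegrable _ _
  have hle := hasSum_le_of_sum_le hsum hfin
  rw [intervalIntegral.integral_const_mul] at hle
  have : (2 * Real.pi)⁻¹ * (∫ y in -Real.pi..Real.pi,
      ‖G (Complex.exp (u + y * Complex.I))‖ ^ 2) ≤ (2 * Real.pi)⁻¹ *
      (m ^ 2 * ((β - α) * ∫ s in α..β, ∫ y in -Real.pi..Real.pi,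
        ‖dbarTwist G (Complex.exp (s + y * Complex.I))‖ ^ 2)) := by
    refine hle.trans_eq (by ring)
  exact le_of_mul_le_mul_left this (by positivity)

/-! ### A weighted `∂̄`-estimate -/

lemma lintegral_eq_logPolar {F : ℂ → ℝ≥0∞} (hF : Measurable F) :
    ∫⁻ z, F z = ∫⁻ s : ℝ, ∫⁻ y in Set.Ioc (-Real.pi) Real.pi,
      ENNReal.ofReal (Real.exp (2 * s)) * F (Complex.exp (s + y * Complex.I)) := by
  rw [← Complex.lintegral_comp_polarCoord_symm, polarCoord_target,
    Measure.volume_eq_prod, ← Measure.prod_restrict, lintegral_prod]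
  swap
  · have h1 : Measurable (fun p : ℝ × ℝ => Complex.polarCoord.symm p) := by
      simp only [Complex.polarCoord_symm_apply]
      fun_prop
    exact (Measurable.mul (by fun_prop) (hF.comp h1)).aemeasurable
  have himg : Set.Ioi (0 : ℝ) = Real.exp '' Set.univ := by rw [Set.image_univ, Real.range_exp]
  rw [himg, lintegral_image_eq_lintegral_abs_deriv_mul MeasurableSet.univ
    (fun s _ => (Real.hasDerivAt_exp s).hasDerivWithinAt) Real.exp_injective.injOn,
    Measure.restrict_univ]
  refine lintegral_congr fun s => ?_
  rw [setLIntegral_congr (Ioo_ae_eq_Ioc (a := -Real.pi) (b := Real.pi)), abs_of_pos (Real.exp_pos s),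
    ← lintegral_const_mul']
  swap
  · exact ENNReal.ofReal_ne_top
  refine lintegral_congr fun y => ?_
  have e : Complex.polarCoord.symm (Real.exp s, y) = Complex.exp (s + y * Complex.I) := by
    rw [Complex.polarCoord_symm_apply, Complex.exp_add, Complex.exp_mul_I]
    push_cast
    rfl
  simp only [smul_eq_mul, e]
  rw [← mul_assoc, ← ENNReal.ofReal_mul (Real.exp_pos s).le, ← Real.exp_add, two_mul]

/-- The radial integral of the power weight against the profile `min 1 (b / r) ^ 2`, in the variable
`log r`; it converges at the origin because `σ < 1` and at infinity because `0 < σ`. -/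
lemma lintegral_weight_le {σ : ℝ} (hσ0 : 0 < σ) (hσ1 : σ < 1) (β : ℝ) :
    ∫⁻ s : ℝ, ENNReal.ofReal (Real.exp (2 * s) * (1 + Real.exp s) ^ (-2 * σ) *
      min 1 (Real.exp (β - s)) ^ 2) ≤
      ENNReal.ofReal ((1 / (2 - 2 * σ) + 1 / (2 * σ)) * Real.exp ((2 - 2 * σ) * β)) := by
  have hw : ∀ s : ℝ, (1 + Real.exp s) ^ (-2 * σ) ≤ Real.exp (-2 * σ * s) := by
    intro s
    rw [mul_comm (-2 * σ) s, Real.exp_mul]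
    exact Real.rpow_le_rpow_of_nonpos (Real.exp_pos s) (by linarith) (by linarith)
  have hpos : ∀ s : ℝ, 0 ≤ (1 + Real.exp s) ^ (-2 * σ) := fun s => by positivity
  rw [← lintegral_add_compl _ (measurableSet_Iic (a := β)), Set.compl_Iic]
  have h1 : ∫⁻ s in Set.Iic β, ENNReal.ofReal (Real.exp (2 * s) * (1 + Real.exp s) ^ (-2 * σ) *
      min 1 (Real.exp (β - s)) ^ 2) ≤
      ENNReal.ofReal (1 / (2 - 2 * σ) * Real.exp ((2 - 2 * σ) * β)) := by
    have hc : (0 : ℝ) < 2 - 2 * σ := by linarith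
    calc _ ≤ ∫⁻ s in Set.Iic β, ENNReal.ofReal (Real.exp ((2 - 2 * σ) * s)) := by
          refine lintegral_mono fun s => ENNReal.ofReal_le_ofReal ?_
          have hm : min 1 (Real.exp (β - s)) ^ 2 ≤ 1 :=
            pow_le_one₀ (le_min zero_le_one (Real.exp_pos _).le) (min_le_left _ _)
          calc _ ≤ Real.exp (2 * s) * Real.exp (-2 * σ * s) * 1 := by gcongr; exact hw s
            _ = _ := by rw [mul_one, ← Real.exp_add]; ring_nf
      _ = ENNReal.ofReal (∫ s in Set.Iic β, Real.exp ((2 - 2 * σ) * s)) := by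
          rw [ofReal_integral_eq_lintegral_ofReal]
          · exact integrableOn_exp_mul_Iic hc β
          · exact Eventually.of_forall fun _ => (Real.exp_pos _).le
      _ = _ := by rw [integral_exp_mul_Iic hc]; ring_nf
  have h2 : ∫⁻ s in Set.Ioi β, ENNReal.ofReal (Real.exp (2 * s) * (1 + Real.exp s) ^ (-2 * σ) *
      min 1 (Real.exp (β - s)) ^ 2) ≤
      ENNReal.ofReal (1 / (2 * σ) * Real.exp ((2 - 2 * σ) * β)) := by
    have hc : -2 * σ < 0 := by linarith
    calc _ ≤ ∫⁻ s in Set.Ioi β, ENNReal.ofReal (Real.exp (2 * β) * Real.exp (-2 * σ * s)) := by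
          refine lintegral_mono fun s => ENNReal.ofReal_le_ofReal ?_
          have hm : min 1 (Real.exp (β - s)) ^ 2 ≤ Real.exp (β - s) ^ 2 := by
            have : 0 ≤ min 1 (Real.exp (β - s)) := le_min zero_le_one (Real.exp_pos _).le
            gcongr
            exact min_le_right _ _
          calc _ ≤ Real.exp (2 * s) * Real.exp (-2 * σ * s) * Real.exp (β - s) ^ 2 := by
                gcongr; exact hw s
            _ = _ := by rw [sq, ← Real.exp_add, ← Real.exp_add, ← Real.exp_add, ← Real.exp_add]; ring_nf
      _ = ENNReal.ofReal (∫ s in Set.Ioi β, Real.exp (2 * β) * Real.exp (-2 * σ * s)) := by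
          rw [ofReal_integral_eq_lintegral_ofReal]
          · exact (integrableOn_exp_mul_Ioi hc β).const_mul _
          · exact Eventually.of_forall fun _ => by positivity
      _ = _ := by
          rw [integral_const_mul, integral_exp_mul_Ioi hc]
          congr 1
          rw [show Real.exp ((2 - 2 * σ) * β) = Real.exp (2 * β) * Real.exp (-2 * σ * β) by
            rw [← Real.exp_add]; ring_nf]
          field_simp
  refine (add_le_add h1 h2).trans_eq ?_
  rw [← ENNReal.ofReal_add, ← add_mul]
  · have : (0 : ℝ) < 2 - 2 * σ := by linarith
    positivity
  · positivity

/-- A weighted `L²` estimate for the equation `∂̄G = h` with `h` supported in an annulus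
`a ≤ |z| ≤ b`. The gain is the factor `(b - a) / a`: it is small for thin annuli. -/
theorem lintegral_sq_mul_weight_le {G : ℂ → ℂ} (hG : ContDiff ℝ 1 G)
    (hinf : Tendsto G (cocompact ℂ) (𝓝 0)) {a b : ℝ} (ha : 0 < a) (hab : a ≤ b)
    (hsupp : ∀ z : ℂ, ‖z‖ ∉ Set.Icc a b → dbarTwist G z = 0)
    {σ : ℝ} (hσ0 : 0 < σ) (hσ1 : σ < 1) :
    ∫⁻ z, ENNReal.ofReal (‖G z‖ ^ 2 * (1 + ‖z‖) ^ (-2 * σ)) ≤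
      ENNReal.ofReal ((1 / (2 - 2 * σ) + 1 / (2 * σ)) * b ^ (2 - 2 * σ) * ((b - a) / a)) *
        ∫⁻ z, ENNReal.ofReal ((‖dbarTwist G z‖ / ‖z‖) ^ 2) := by
  have hb : 0 < b := ha.trans_le hab
  have hD := continuous_dbarTwist hG
  set α := Real.log a with hα
  set β := Real.log b with hβ
  have hαβ : α ≤ β := Real.log_le_log ha hab
  have hea : Real.exp α = a := Real.exp_log ha
  have heb : Real.exp β = b := Real.exp_log hb
  have hpi := Real.pi_pos
  have hnorm : ∀ s y : ℝ, ‖Complex.exp (s + y * Complex.I)‖ = Real.exp s := fun s y => by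
    rw [Complex.norm_exp]; simp
  have hlint : ∀ g : ℝ → ℝ, Continuous g → (∀ y, 0 ≤ g y) →
      ∫⁻ y in Set.Ioc (-Real.pi) Real.pi, ENNReal.ofReal (g y) =
        ENNReal.ofReal (∫ y in -Real.pi..Real.pi, g y) := by
    intro g hg hg0
    rw [intervalIntegral.integral_of_le (by linarith), ofReal_integral_eq_lintegral_ofReal]
    · exact hg.integrableOn_Ioc
    · exact Eventually.of_forall hg0
  set D : ℝ → ℝ := fun s => ∫ y in -Real.pi..Real.pi,
        ‖dbarTwist G (Complex.exp (s + y * Complex.I))‖ ^ 2 with hDdef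
  have hDc : Continuous D := by
    refine intervalIntegral.continuous_parametric_intervalIntegral_of_continuous' ?_ _ _
    fun_prop
  have hD0 : ∀ s, 0 ≤ D s := fun s =>
    intervalIntegral.integral_nonneg (by linarith) fun _ _ => sq_nonneg _
  -- the right-hand side in logarithmic polar coordinates
  have hR : ENNReal.ofReal (∫ s in α..β, D s) ≤
      ∫⁻ z, ENNReal.ofReal ((‖dbarTwist G z‖ / ‖z‖) ^ 2) := by
    rw [lintegral_eq_logPolar (by fun_prop), intervalIntegral.integral_of_le hαβ,
      ofReal_integral_eq_lintegral_ofReal hDc.integrableOn_Ioc (Eventually.of_forall hD0)]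
    refine (setLIntegral_le_lintegral _ _).trans (lintegral_mono fun s => ?_)
    rw [hDdef, ← hlint _ (by fun_prop) (fun _ => sq_nonneg _)]
    refine lintegral_mono fun y => ?_
    rw [← ENNReal.ofReal_mul (Real.exp_pos _).le, hnorm]
    refine ENNReal.ofReal_le_ofReal (le_of_eq ?_)
    have : Real.exp (2 * s) = Real.exp s ^ 2 := by rw [sq, ← Real.exp_add, two_mul]
    rw [this]
    field_simp
  have hwidth : β - α ≤ (b - a) / a := by
    rw [hα, hβ, ← Real.log_div hb.ne' ha.ne', sub_div, div_self ha.ne']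
    exact Real.log_le_sub_one_of_pos (by positivity)
  have hσ2 : (0 : ℝ) < 2 - 2 * σ := by linarith
  have hGc := hG.continuous
  rw [lintegral_eq_logPolar (by fun_prop)]
  calc _ ≤ ∫⁻ s : ℝ, ENNReal.ofReal (Real.exp (2 * s) * (1 + Real.exp s) ^ (-2 * σ) *
        min 1 (Real.exp (β - s)) ^ 2) * ENNReal.ofReal ((β - α) * ∫ s in α..β, D s) := by
        refine lintegral_mono fun s => ?_
        have hw0 : 0 ≤ Real.exp (2 * s) * (1 + Real.exp s) ^ (-2 * σ) := by positivity
        have e : ∀ y : ℝ, ENNReal.ofReal (Real.exp (2 * s)) *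
            ENNReal.ofReal (‖G (Complex.exp (s + y * Complex.I))‖ ^ 2 *
              (1 + ‖Complex.exp (s + y * Complex.I)‖) ^ (-2 * σ)) =
            ENNReal.ofReal (Real.exp (2 * s) * (1 + Real.exp s) ^ (-2 * σ)) *
              ENNReal.ofReal (‖G (Complex.exp (s + y * Complex.I))‖ ^ 2) := by
          intro y
          rw [← ENNReal.ofReal_mul (Real.exp_pos _).le, hnorm, ← ENNReal.ofReal_mul hw0]
          ring_nf
        simp only [e]
        rw [lintegral_const_mul' _ _ ENNReal.ofReal_ne_top, hlint _ (by fun_prop)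
          (fun _ => sq_nonneg _), ← ENNReal.ofReal_mul hw0, ← ENNReal.ofReal_mul (by positivity)]
        refine ENNReal.ofReal_le_ofReal ?_
        rw [mul_assoc (Real.exp (2 * s) * _)]
        refine mul_le_mul_of_nonneg_left ?_ hw0
        exact integral_sq_circle_le hG hinf hαβ (by rw [hea, heb]; exact hsupp) s
    _ ≤ ENNReal.ofReal ((1 / (2 - 2 * σ) + 1 / (2 * σ)) * Real.exp ((2 - 2 * σ) * β)) *
        ENNReal.ofReal ((β - α) * ∫ s in α..β, D s) := by
        rw [lintegral_mul_const' _ _ ENNReal.ofReal_ne_top]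
        gcongr
        exact lintegral_weight_le hσ0 hσ1 β
    _ = ENNReal.ofReal ((1 / (2 - 2 * σ) + 1 / (2 * σ)) * b ^ (2 - 2 * σ) * (β - α)) *
        ENNReal.ofReal (∫ s in α..β, D s) := by
        have : 0 ≤ β - α := sub_nonneg.2 hαβ
        rw [← ENNReal.ofReal_mul (by positivity), ← ENNReal.ofReal_mul (by positivity),
          Real.rpow_def_of_pos hb, ← hβ, mul_comm β (2 - 2 * σ)]
        ring_nf
    _ ≤ _ := by gcongr

/-! ### Slow variation of `ρ` -/

/-- Comparability of `r (x + C * r x)` and `r x` for each fixed `C` holds with one constant for all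
`C` in some interval: by Baire's theorem one of the closed sets of those `C` for which a given
constant works has interior. -/
lemma exists_uniform_comparable {r : ℝ → ℝ} (hr : Continuous r) (hpos : ∀ x, 0 < r x)
    (hcomp : ∀ C : ℝ, 0 < C → ComparableOn (Set.Ioi 0) (fun x => r (x + C * r x)) r) :
    ∃ a b K : ℝ, 0 < a ∧ a < b ∧ 1 ≤ K ∧ ∀ C ∈ Set.Icc a b, ∀ x > 0,
      r (x + C * r x) ≤ K * r x ∧ r x ≤ K * r (x + C * r x) := by
  -- the half-line `C ≤ 1` is added so that the sets cover `ℝ`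
  let E : ℕ → Set ℝ := fun k => {C | C ∈ Set.Iic 1 ∨ ∀ x > 0,
      r (x + C * r x) ≤ (k + 1) * r x ∧ r x ≤ (k + 1) * r (x + C * r x)}
  have hE : ∀ k, IsClosed (E k) := by
    intro k
    have : {C : ℝ | ∀ x > 0, r (x + C * r x) ≤ (k + 1) * r x ∧
        r x ≤ (k + 1) * r (x + C * r x)} = ⋂ x : ℝ, ⋂ _ : 0 < x,
        {C : ℝ | r (x + C * r x) ≤ (k + 1) * r x} ∩ {C : ℝ | r x ≤ (k + 1) * r (x + C * r x)} := by
      ext C; simp [forall_and]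
    refine isClosed_Iic.union (s₂ := {C : ℝ | ∀ x > 0, r (x + C * r x) ≤ (k + 1) * r x ∧
        r x ≤ (k + 1) * r (x + C * r x)}) ?_
    rw [this]
    refine isClosed_iInter fun x => isClosed_iInter fun _ => IsClosed.inter ?_ ?_
    · exact isClosed_le (by fun_prop) (by fun_prop)
    · exact isClosed_le (by fun_prop) (by fun_prop)
  have hU : (⋃ k, E k) = Set.univ := by
    refine Set.eq_univ_of_forall fun C => ?_
    rw [Set.mem_iUnion]
    rcases le_or_gt C 1 with h1 | h1
    · exact ⟨0, Or.inl h1⟩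
    · obtain ⟨K, hK0, hK⟩ := hcomp C (by linarith)
      obtain ⟨k, hk⟩ := exists_nat_ge K
      refine ⟨k, Or.inr fun x hx => ?_⟩
      have h2 := hK x hx
      have h3 : K ≤ k + 1 := by linarith
      exact ⟨h2.1.trans (by gcongr; exact (hpos _).le),
        h2.2.trans (by gcongr; exact (hpos _).le)⟩
  have hdense := dense_iUnion_interior_of_closed hE hU
  obtain ⟨C, hC, hCm⟩ := hdense.inter_open_nonempty (Set.Ioi 1) isOpen_Ioi ⟨2, by simp⟩
  rw [Set.mem_iUnion] at hCm
  obtain ⟨k, hk⟩ := hCm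
  have hC' : C ∈ interior (E k) ∩ Set.Ioi 1 := ⟨hk, hC⟩
  obtain ⟨ε, hε, hball⟩ := Metric.isOpen_iff.1 (isOpen_interior.inter isOpen_Ioi) C hC'
  rw [Set.mem_Ioi] at hC
  refine ⟨C, C + ε / 2, k + 1, by linarith, by linarith, by simp, fun C' hC' => ?_⟩
  have hmem : C' ∈ Metric.ball C ε := by
    rw [Metric.mem_ball, Real.dist_eq, abs_lt]
    constructor <;> linarith [hC'.1, hC'.2]
  have h1 := hball hmem
  rcases interior_subset h1.1 with h2 | h2
  · exact absurd (Set.mem_Ioi.1 h1.2) (not_lt.2 h2)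
  · exact h2

/-- On intervals around `x` of length a small multiple of `r x`, the function `r` is comparable to
`r x`. The hypothesis gives this only on intervals to the right of a point `z`; but every large `x`
is the midpoint of such an interval, as `z + m * r z` takes all large values. -/
theorem exists_slowlyVarying {r : ℝ → ℝ} (hr : Continuous r) (hpos : ∀ x, 0 < r x)
    (hcomp : ∀ C : ℝ, 0 < C → ComparableOn (Set.Ioi 0) (fun x => r (x + C * r x)) r) :
    ∃ c K : ℝ, 0 < c ∧ 1 ≤ K ∧ ∀ x y, 0 ≤ x → 0 ≤ y → |y - x| ≤ c * r x →
      r y ≤ K * r x ∧ r x ≤ K * r y := by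
  obtain ⟨a, b, K, ha, hab, hK, hcmp⟩ := exists_uniform_comparable hr hpos hcomp
  set m := (a + b) / 2 with hm
  -- the constants for a compact interval
  set X := m * r 0 + 1 with hX
  have hm0 : 0 < m := by rw [hm]; linarith
  have hX1 : 0 < X := by have := hpos 0; positivity
  obtain ⟨x₁, hx₁, hmax⟩ := (isCompact_Icc (a := (0 : ℝ)) (b := X + 1)).exists_isMaxOn
    ⟨0, by constructor <;> linarith⟩ hr.continuousOn
  obtain ⟨x₂, hx₂, hmin⟩ := (isCompact_Icc (a := (0 : ℝ)) (b := X + 1)).exists_isMinOn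
    ⟨0, by constructor <;> linarith⟩ hr.continuousOn
  set M := r x₁ with hM
  set μ := r x₂ with hμ
  have hM0 : 0 < M := hpos _
  have hμ0 : 0 < μ := hpos _
  refine ⟨min ((b - a) / 2 / K) (1 / M), max (K ^ 2) (M / μ), ?_, ?_, ?_⟩
  · have : 0 < b - a := by linarith
    positivity
  · exact le_max_of_le_left (one_le_pow₀ hK)
  intro x y hx hy hxy
  rcases le_or_gt x X with hxX | hxX
  · have hrx : r x ≤ M := hmax ⟨hx, by linarith⟩
    have hd : |y - x| ≤ 1 := hxy.trans (by
      calc _ ≤ 1 / M * M := by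
            gcongr
            · exact (hpos x).le
            · exact min_le_right _ _
        _ = 1 := by field_simp)
    have hyX : y ≤ X + 1 := by have := (abs_le.1 hd).2; linarith
    have hry : r y ≤ M := hmax ⟨hy, hyX⟩
    have hrx' : μ ≤ r x := hmin ⟨hx, by linarith⟩
    have hry' : μ ≤ r y := hmin ⟨hy, hyX⟩
    have key : M ≤ max (K ^ 2) (M / μ) * μ := by
      calc M = M / μ * μ := by field_simp
        _ ≤ _ := by gcongr; exact le_max_right _ _
    constructor
    · exact hry.trans (key.trans (by gcongr))
    · exact hrx.trans (key.trans (by gcongr))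
  · -- `x = z + m r(z)` is the midpoint of an interval on which `r` is comparable to `r(z)`
    have hcont : ContinuousOn (fun z => z + m * r z) (Set.Icc 0 x) := by fun_prop
    obtain ⟨z, hz, hzx⟩ := intermediate_value_Icc hx hcont
      (show x ∈ Set.Icc _ _ by
        have := hpos x
        constructor
        · linarith
        · nlinarith)
    have hz0 : 0 < z := by
      rcases hz.1.eq_or_lt with h | h
      · rw [← h] at hzx; simp only at hzx; linarith
      · exact h
    simp only at hzx
    have hx1 := hcmp m ⟨by rw [hm]; linarith, by rw [hm]; linarith⟩ z hz0
    rw [hzx] at hx1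
    have hrz := hpos z
    have hd : |y - x| ≤ (b - a) / 2 * r z := hxy.trans (by
      have : 0 < b - a := by linarith
      calc _ ≤ (b - a) / 2 / K * (K * r z) := by
            have := hx1.1
            have := (hpos x).le
            gcongr
            exact min_le_left _ _
        _ = _ := by field_simp)
    have hd' := abs_le.1 hd
    have hy1 := hcmp ((y - z) / r z) (by
      rw [Set.mem_Icc, le_div_iff₀ hrz, div_le_iff₀ hrz]
      rw [hm] at hzx
      constructor <;> linarith) z hz0
    have e : z + (y - z) / r z * r z = y := by field_simp; ring
    rw [e] at hy1
    have hK0 : 0 ≤ K := by linarith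
    have hle : K ^ 2 ≤ max (K ^ 2) (M / μ) := le_max_left _ _
    constructor
    · calc r y ≤ K * r z := hy1.1
        _ ≤ K * (K * r x) := by gcongr; exact hx1.2
        _ = K ^ 2 * r x := by ring
        _ ≤ _ := by gcongr; exact (hpos x).le
    · calc r x ≤ K * r z := hx1.1
        _ ≤ K * (K * r y) := by gcongr; exact hy1.2
        _ = K ^ 2 * r y := by ring
        _ ≤ _ := by gcongr; exact (hpos y).le

lemma laplacian_radial_rotate {F : ℂ → ℝ} {ω : ℂ} (hω : ‖ω‖ = 1)
    (hrad : ∀ z, F (ω * z) = F z) (hF : ContDiff ℝ 2 F) (z : ℂ) :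
    Laplacian.laplacian F (ω * z) = Laplacian.laplacian F z := by
  let A : ℂ ≃ₗᵢ[ℝ] ℂ := rotation ⟨ω, by simpa [Submonoid.unitSphere] using hω⟩
  have hA : ∀ w, A w = ω * w := fun w => rfl
  have hFA : F ∘ A = F := by ext w; simp [hA, hrad]
  rw [congrFun (InnerProductSpace.laplacian_eq_iteratedFDeriv_orthonormalBasis F
      (Complex.orthonormalBasisOneI.map A)) (ω * z),
    congrFun (InnerProductSpace.laplacian_eq_iteratedFDeriv_orthonormalBasis F
      Complex.orthonormalBasisOneI) z]
  refine Finset.sum_congr rfl fun i _ => ?_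
  conv_rhs => rw [← hFA]
  have h2 := ContinuousLinearMap.iteratedFDeriv_comp_right
    (A.toContinuousLinearEquiv : ℂ →L[ℝ] ℂ) (f := F) (n := 2) hF z (i := 2) le_rfl
  have h3 : F ∘ (A.toContinuousLinearEquiv : ℂ →L[ℝ] ℂ) = F ∘ A := rfl
  rw [h3] at h2
  rw [h2, ContinuousMultilinearMap.compContinuousLinearMap_apply]
  rw [← hA z]
  congr 1
  ext j
  fin_cases j <;> simp

lemma IsFockWeight.rho_eq_norm {φ : ℝ → ℝ} (hφ : IsFockWeight φ) (z : ℂ) :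
    rho φ z = rho φ (‖z‖ : ℂ) := by
  rcases eq_or_ne z 0 with rfl | hz
  · simp
  have hz' : (‖z‖ : ℂ) ≠ 0 := by simpa using hz
  have h := laplacian_radial_rotate (F := fun w : ℂ => φ ‖w‖) (ω := z / ‖z‖)
    (by rw [norm_div, Complex.norm_real, norm_norm]; exact div_self (norm_ne_zero_iff.2 hz))
    (fun w => by
      rw [norm_mul, norm_div, Complex.norm_real, norm_norm, div_self (norm_ne_zero_iff.2 hz),
        one_mul]) hφ.contDiff (‖z‖ : ℂ)
  rw [div_mul_cancel₀ _ hz'] at h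
  rw [rho, rho, h]

lemma IsFockWeight.rho_pos {φ : ℝ → ℝ} (hφ : IsFockWeight φ) (z : ℂ) : 0 < rho φ z :=
  Real.rpow_pos_of_pos (hφ.laplacian_pos z) _

lemma IsFockWeight.continuous_rho {φ : ℝ → ℝ} (hφ : IsFockWeight φ) : Continuous (rho φ) := by
  have h : Continuous (Laplacian.laplacian (fun w : ℂ => φ ‖w‖)) := by
    rw [InnerProductSpace.laplacian_eq_iteratedFDeriv_complexPlane]
    have := hφ.contDiff.continuous_iteratedFDeriv (m := 2) le_rfl
    fun_prop
  exact h.rpow_const fun z => Or.inl (hφ.laplacian_pos z).ne'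

lemma IsFockWeight.laplacian_eq {φ : ℝ → ℝ} (hφ : IsFockWeight φ) (z : ℂ) :
    Laplacian.laplacian (fun w : ℂ => φ ‖w‖) z = (rho φ z ^ 2)⁻¹ := by
  have h := hφ.laplacian_pos z
  rw [rho, ← Real.rpow_natCast, ← Real.rpow_mul h.le, ← Real.rpow_neg h.le]
  norm_num

/-- `ρ` is slowly varying on its own scale, and hence grows at most linearly away from a point,
with a slope that does not depend on the point. -/
theorem IsFockWeight.exists_rho_bounds {φ : ℝ → ℝ} (hφ : IsFockWeight φ) :
    ∃ c K : ℝ, 0 < c ∧ 1 ≤ K ∧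
      (∀ z w : ℂ, |‖w‖ - ‖z‖| ≤ c * rho φ z → rho φ w ≤ K * rho φ z ∧ rho φ z ≤ K * rho φ w) ∧
      ∀ z w : ℂ, rho φ w ≤ K * rho φ z + |‖w‖ - ‖z‖| / c := by
  obtain ⟨c, K, hc, hK, h⟩ := exists_slowlyVarying (r := fun x : ℝ => rho φ (x : ℂ))
    (hφ.continuous_rho.comp Complex.continuous_ofReal) (fun x => hφ.rho_pos _) (fun C hC => by
      simpa using hφ.rho_comparable C hC)
  have h' : ∀ z w : ℂ, |‖w‖ - ‖z‖| ≤ c * rho φ z →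
      rho φ w ≤ K * rho φ z ∧ rho φ z ≤ K * rho φ w := by
    intro z w hzw
    rw [hφ.rho_eq_norm z] at hzw
    rw [hφ.rho_eq_norm z, hφ.rho_eq_norm w]
    exact h ‖z‖ ‖w‖ (norm_nonneg _) (norm_nonneg _) hzw
  refine ⟨c, K, hc, hK, h', fun z w => ?_⟩
  have hz := hφ.rho_pos z
  rcases le_or_gt |‖z‖ - ‖w‖| (c * rho φ w) with h1 | h1
  · have := (h' w z h1).2
    have : 0 ≤ |‖w‖ - ‖z‖| / c := by positivity
    linarith
  · rw [abs_sub_comm] at h1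
    have : rho φ w ≤ |‖w‖ - ‖z‖| / c := by rw [le_div_iff₀ hc]; linarith
    have : 0 ≤ K * rho φ z := by positivity
    linarith

/-! ### A quantitative maximum principle -/

lemma deriv_deriv_line {w : ℂ → ℝ} {z : ℂ} (hw : ContDiffAt ℝ 2 w z) (e : ℂ) :
    deriv (deriv fun s : ℝ => w (z + s • e)) 0 = iteratedFDeriv ℝ 2 w z ![e, e] := by
  have hline : ∀ s : ℝ, HasDerivAt (fun s : ℝ => z + s • e) e s := fun s => by
    simpa using ((hasDerivAt_id s).smul_const e).const_add z
  have hev : ∀ᶠ y in 𝓝 z, ContDiffAt ℝ 2 w y := hw.eventually (by simp)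
  have hev' : ∀ᶠ s : ℝ in 𝓝 0, ContDiffAt ℝ 2 w (z + s • e) := by
    have hc : ContinuousAt (fun s : ℝ => z + s • e) 0 := (hline 0).continuousAt
    have : z + (0 : ℝ) • e = z := by simp
    exact hc.eventually (by simpa only [this] using hev)
  have h1 : (deriv fun s : ℝ => w (z + s • e)) =ᶠ[𝓝 0] fun s => fderiv ℝ w (z + s • e) e := by
    filter_upwards [hev'] with s hs
    exact ((hs.differentiableAt two_ne_zero).hasFDerivAt.comp_hasDerivAt s (hline s)).deriv
  rw [h1.deriv_eq, iteratedFDeriv_two_apply]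
  have h2 : DifferentiableAt ℝ (fderiv ℝ w) z :=
    (hw.fderiv_right (m := 1) (by norm_num)).differentiableAt one_ne_zero
  have h3 : HasFDerivAt (fderiv ℝ w) (fderiv ℝ (fderiv ℝ w) z) (z + (0 : ℝ) • e) := by
    simpa using h2.hasFDerivAt
  have h4 : HasDerivAt (fun s : ℝ => fderiv ℝ w (z + s • e)) (fderiv ℝ (fderiv ℝ w) z e) 0 :=
    HasFDerivAt.comp_hasDerivAt (0 : ℝ) h3 (hline 0)
  have h5 : HasDerivAt (fun s : ℝ => fderiv ℝ w (z + s • e) e) (fderiv ℝ (fderiv ℝ w) z e e) 0 :=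
    (ContinuousLinearMap.apply ℝ ℝ e).hasFDerivAt.comp_hasDerivAt (0 : ℝ) h4
  rw [h5.deriv]
  rfl

lemma laplacian_nonpos_of_isLocalMax {w : ℂ → ℝ} {z : ℂ} (hw : ContDiffAt ℝ 2 w z)
    (hmax : IsLocalMax w z) : Laplacian.laplacian w z ≤ 0 := by
  have key : ∀ e : ℂ, iteratedFDeriv ℝ 2 w z ![e, e] ≤ 0 := by
    intro e
    rw [← deriv_deriv_line hw e]
    by_contra! hpos
    have hc : ContinuousAt (fun s : ℝ => z + s • e) 0 := by fun_prop
    have h0 : z + (0 : ℝ) • e = z := by simp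
    have hmax' : IsLocalMax (fun s : ℝ => w (z + s • e)) 0 := by
      have := hc.eventually (p := fun y => w y ≤ w z) (by simp only [h0]; exact hmax)
      simpa [IsLocalMax, IsMaxFilter] using this
    have hwc : ContinuousAt (fun s : ℝ => w (z + s • e)) 0 :=
      ContinuousAt.comp (by rw [h0]; exact hw.continuousAt) hc
    have hmin := isLocalMin_of_deriv_deriv_pos hpos hmax'.deriv_eq_zero hwc
    have hconst : (fun s : ℝ => w (z + s • e)) =ᶠ[𝓝 0] fun _ => w (z + (0 : ℝ) • e) := by
      filter_upwards [hmax', hmin] with s h1 h2 using le_antisymm h1 h2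
    have hd := hconst.deriv
    have : deriv (deriv fun s : ℝ => w (z + s • e)) 0 = 0 := by
      rw [hd.deriv_eq]; simp
    linarith
  rw [congrFun (InnerProductSpace.laplacian_eq_iteratedFDeriv_complexPlane w) z]
  linarith [key 1, key Complex.I]

/-- The barrier `√(1 + x²) + (y² - x²) / (2t)` in the coordinates `x + iy = (z - z₀) ω̄ / ρ`. Its
value is `1` at the centre and at least `t / 2` on the circle `x² + y² = t²`, while its Laplacian is
`(1 + x²)^(-3/2)`, which is concentrated on the strip where `x` is bounded. -/
noncomputable def barrier (z₀ ω : ℂ) (ρ t : ℝ) (z : ℂ) : ℝ :=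
  √(1 + (((z - z₀) * (starRingEnd ℂ) ω).re / ρ) ^ 2) +
    (‖z - z₀‖ ^ 2 / ρ ^ 2 - 2 * (((z - z₀) * (starRingEnd ℂ) ω).re / ρ) ^ 2) / (2 * t)

lemma contDiff_barrier (z₀ ω : ℂ) (ρ t : ℝ) : ContDiff ℝ 2 (barrier z₀ ω ρ t) := by
  have h1 : ContDiff ℝ 2 fun z : ℂ => ((z - z₀) * (starRingEnd ℂ) ω).re / ρ := by
    have : ContDiff ℝ 2 fun z : ℂ => (z - z₀) * (starRingEnd ℂ) ω := by fun_prop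
    exact (Complex.reCLM.contDiff.comp this).div_const ρ
  have h2 : ContDiff ℝ 2 fun z : ℂ => ‖z - z₀‖ ^ 2 :=
    (contDiff_id.sub contDiff_const).norm_sq ℝ
  refine ContDiff.add (ContDiff.sqrt (by fun_prop) fun z => by positivity) ?_
  exact ((h2.div_const _).sub (contDiff_const.mul (h1.pow 2))).div_const _

lemma laplacian_barrier_le {z₀ ω : ℂ} {ρ t : ℝ} (hω : ‖ω‖ = 1) (hρ : 0 < ρ) (z : ℂ) :
    Laplacian.laplacian (barrier z₀ ω ρ t) z ≤
      1 / (ρ ^ 2 * (1 + (((z - z₀) * (starRingEnd ℂ) ω).re / ρ) ^ 2)) := by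
  set x := ((z - z₀) * (starRingEnd ℂ) ω).re / ρ with hx
  have key : ∀ e : ℂ, iteratedFDeriv ℝ 2 (barrier z₀ ω ρ t) z ![e, e] =
      ((e * (starRingEnd ℂ) ω).re / ρ) ^ 2 / ((1 + x ^ 2) * √(1 + x ^ 2)) +
        (2 * ‖e‖ ^ 2 / ρ ^ 2 - 4 * ((e * (starRingEnd ℂ) ω).re / ρ) ^ 2) / (2 * t) := by
    intro e
    rw [← deriv_deriv_line (contDiff_barrier z₀ ω ρ t).contDiffAt]
    set a := (e * (starRingEnd ℂ) ω).re / ρ with ha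
    set b := ((z - z₀) * (starRingEnd ℂ) e).re with hb
    have hline : (fun s : ℝ => barrier z₀ ω ρ t (z + s • e)) = fun s =>
        √(1 + (x + s * a) ^ 2) + ((‖z - z₀‖ ^ 2 + s * (2 * b) + s ^ 2 * ‖e‖ ^ 2) / ρ ^ 2 -
          2 * (x + s * a) ^ 2) / (2 * t) := by
      ext s
      have e1 : ((z + s • e - z₀) * (starRingEnd ℂ) ω).re / ρ = x + s * a := by
        rw [hx, ha]
        simp only [Complex.real_smul, Complex.mul_re, Complex.add_re, Complex.sub_re,
          Complex.add_im, Complex.sub_im, Complex.mul_im, Complex.ofReal_re, Complex.ofReal_im]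
        ring
      have e2 : ‖z + s • e - z₀‖ ^ 2 = ‖z - z₀‖ ^ 2 + s * (2 * b) + s ^ 2 * ‖e‖ ^ 2 := by
        rw [hb, Complex.sq_norm, Complex.sq_norm, Complex.sq_norm]
        simp [Complex.normSq_apply]
        ring
      rw [barrier, e1, e2]
    have hpos : ∀ s : ℝ, 0 < 1 + (x + s * a) ^ 2 := fun s => by positivity
    have hlin : ∀ s : ℝ, HasDerivAt (fun s : ℝ => x + s * a) a s := fun s => by
      simpa using ((hasDerivAt_id s).mul_const a).const_add x
    have hsq : ∀ s : ℝ, HasDerivAt (fun s : ℝ => √(1 + (x + s * a) ^ 2))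
        (a * (x + s * a) / √(1 + (x + s * a) ^ 2)) s := fun s => by
      have := (((hlin s).pow 2).const_add 1).sqrt (hpos s).ne'
      refine this.congr_deriv ?_
      simp only [Nat.cast_ofNat, Nat.add_one_sub_one, pow_one, Pi.pow_apply]
      rw [mul_assoc, mul_div_mul_left _ _ two_ne_zero, mul_comm]
    have hd1 : ∀ s : ℝ, HasDerivAt (fun s : ℝ => √(1 + (x + s * a) ^ 2) +
        ((‖z - z₀‖ ^ 2 + s * (2 * b) + s ^ 2 * ‖e‖ ^ 2) / ρ ^ 2 -
          2 * (x + s * a) ^ 2) / (2 * t))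
        (a * (x + s * a) / √(1 + (x + s * a) ^ 2) +
          ((2 * b + 2 * s * ‖e‖ ^ 2) / ρ ^ 2 - 4 * a * (x + s * a)) / (2 * t)) s := fun s => by
      have h1 : HasDerivAt (fun s : ℝ => ‖z - z₀‖ ^ 2 + s * (2 * b) + s ^ 2 * ‖e‖ ^ 2)
          (2 * b + 2 * s * ‖e‖ ^ 2) s := by
        have := (((hasDerivAt_id s).mul_const (2 * b)).const_add (‖z - z₀‖ ^ 2)).add
          (((hasDerivAt_id s).pow 2).mul_const (‖e‖ ^ 2))
        refine this.congr_deriv ?_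
        simp
      have h2 := (hsq s).add (((h1.div_const (ρ ^ 2)).sub
        (((hlin s).pow 2).const_mul 2)).div_const (2 * t))
      refine h2.congr_deriv ?_
      simp
      ring
    rw [hline, funext fun s => (hd1 s).deriv]
    have h3 : HasDerivAt (fun s : ℝ => a * (x + s * a) / √(1 + (x + s * a) ^ 2) +
          ((2 * b + 2 * s * ‖e‖ ^ 2) / ρ ^ 2 - 4 * a * (x + s * a)) / (2 * t))
        (a ^ 2 / ((1 + x ^ 2) * √(1 + x ^ 2)) +
          (2 * ‖e‖ ^ 2 / ρ ^ 2 - 4 * a ^ 2) / (2 * t)) 0 := by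
      have h4 := ((hlin 0).const_mul a).div (hsq 0) (Real.sqrt_pos.2 (hpos 0)).ne'
      have h5 : HasDerivAt (fun s : ℝ => 2 * b + 2 * s * ‖e‖ ^ 2) (2 * ‖e‖ ^ 2) 0 := by
        simpa using (((hasDerivAt_id (0 : ℝ)).const_mul 2).mul_const (‖e‖ ^ 2)).const_add (2 * b)
      have h6 := h4.add (((h5.div_const (ρ ^ 2)).sub
        ((hlin 0).const_mul (4 * a))).div_const (2 * t))
      refine h6.congr_deriv ?_
      have hS : 0 < 1 + x ^ 2 := by positivity
      have hsS : √(1 + x ^ 2) ^ 2 = 1 + x ^ 2 := Real.sq_sqrt hS.le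
      have hs0 : 0 < √(1 + x ^ 2) := Real.sqrt_pos.2 hS
      simp only [zero_mul, add_zero]
      congr 1
      · rw [hsS]
        field_simp
        rw [hsS]
        ring
      · ring
    exact h3.deriv
  rw [congrFun (InnerProductSpace.laplacian_eq_iteratedFDeriv_complexPlane _) z, key, key]
  have hsum : ω.re ^ 2 + ω.im ^ 2 = 1 := by
    have := Complex.sq_norm ω
    rw [hω, Complex.normSq_apply] at this
    linarith
  have h1 : 1 ≤ √(1 + x ^ 2) := by
    rw [Real.one_le_sqrt]; nlinarith [sq_nonneg x]
  have h2 : 0 < 1 + x ^ 2 := by positivity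
  simp only [one_mul, Complex.conj_re, Complex.mul_re, Complex.I_re, zero_mul, Complex.conj_im,
    Complex.I_im, zero_sub, neg_neg, norm_one, Complex.norm_I]
  calc _ = (ω.re ^ 2 + ω.im ^ 2) / ρ ^ 2 / ((1 + x ^ 2) * √(1 + x ^ 2)) +
        (4 / ρ ^ 2 * (1 - (ω.re ^ 2 + ω.im ^ 2))) / (2 * t) := by ring
    _ = 1 / (ρ ^ 2 * (1 + x ^ 2) * √(1 + x ^ 2)) := by rw [hsum]; field_simp; simp
    _ ≤ 1 / (ρ ^ 2 * (1 + x ^ 2)) := by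
        exact one_div_le_one_div_of_le (by positivity) (le_mul_of_one_le_right (by positivity) h1)

/-- A function whose Laplacian is bounded below on a long thin strip through the centre of a disc
grows linearly in the length of the strip. -/
theorem exists_sphere_add_le {W : ℂ → ℝ} {z₀ ω : ℂ} {ρ t κ : ℝ} (hω : ‖ω‖ = 1) (hρ : 0 < ρ)
    (ht : 0 < t) (hκ : 0 < κ)
    (hW : ∀ z ∈ Metric.closedBall z₀ (t * ρ), ContDiffAt ℝ 2 W z)
    (hlap : ∀ z ∈ Metric.closedBall z₀ (t * ρ),
      κ / (ρ ^ 2 * (1 + (((z - z₀) * (starRingEnd ℂ) ω).re / ρ) ^ 2)) <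
        Laplacian.laplacian W z) :
    ∃ z ∈ Metric.sphere z₀ (t * ρ), W z₀ + κ * (t / 2 - 1) ≤ W z := by
  set v := barrier z₀ ω ρ t with hv
  have hvd : ContDiff ℝ 2 v := contDiff_barrier z₀ ω ρ t
  have hwd : ∀ z ∈ Metric.closedBall z₀ (t * ρ), ContDiffAt ℝ 2 (W - κ • v) z := fun z hz =>
    (hW z hz).sub (hvd.contDiffAt.const_smul κ)
  obtain ⟨z, hz, hmax⟩ := (isCompact_closedBall z₀ (t * ρ)).exists_isMaxOn
    ⟨z₀, Metric.mem_closedBall_self (by positivity)⟩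
    (fun y hy => (hwd y hy).continuousAt.continuousWithinAt)
  have hsph : z ∈ Metric.sphere z₀ (t * ρ) := by
    rcases (Metric.mem_closedBall.1 hz).eq_or_lt with h | h
    · exact h
    exfalso
    have hloc : IsLocalMax (W - κ • v) z :=
      hmax.isLocalMax (Filter.mem_of_superset (Metric.isOpen_ball.mem_nhds h)
        Metric.ball_subset_closedBall)
    have h1 := laplacian_nonpos_of_isLocalMax (hwd z hz) hloc
    rw [(hW z hz).laplacian_sub (f₂ := κ • v) (hvd.contDiffAt.const_smul κ),
      InnerProductSpace.laplacian_smul κ hvd.contDiffAt, smul_eq_mul] at h1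
    have h2 := mul_le_mul_of_nonneg_left (laplacian_barrier_le (z₀ := z₀) (t := t) hω hρ z) hκ.le
    rw [mul_one_div] at h2
    have h3 := hlap z hz
    linarith
  refine ⟨z, hsph, ?_⟩
  have h1 : W z₀ - κ * v z₀ ≤ W z - κ * v z := hmax (Metric.mem_closedBall_self (by positivity))
  have h2 : v z₀ = 1 := by simp [hv, barrier]
  have h3 : t / 2 ≤ v z := by
    have hn : ‖z - z₀‖ = t * ρ := by rw [← dist_eq_norm]; exact hsph
    simp only [hv, barrier, hn]
    set x := ((z - z₀) * (starRingEnd ℂ) ω).re / ρ with hx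
    have hxt : |x| ≤ t := by
      rw [hx, abs_div, abs_of_pos hρ, div_le_iff₀ hρ, ← hn]
      refine (Complex.abs_re_le_norm _).trans ?_
      rw [norm_mul, RCLike.norm_conj, hω, mul_one]
    have h4 : |x| ≤ √(1 + x ^ 2) := Real.abs_le_sqrt (by linarith)
    have h5 : (((t * ρ) ^ 2 / ρ ^ 2 - 2 * x ^ 2) / (2 * t)) = t / 2 - |x| * |x| / t := by
      rw [abs_mul_abs_self]; field_simp
    have h6 : |x| * |x| / t ≤ |x| := by
      rw [div_le_iff₀ ht]; gcongr
    rw [h5]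
    linarith
  rw [h2] at h1
  nlinarith

/-! ### Gaps between the zeros -/

lemma exists_linear_gt_log {κ : ℝ} (hκ : 0 < κ) (C : ℝ) :
    ∃ t : ℝ, 2 ≤ t ∧ C + Real.log (1 + t) < κ * (t / 2 - 1) := by
  have h1 : ∀ᶠ x : ℝ in atTop, ‖Real.log x‖ ≤ κ / 4 * ‖id x‖ :=
    Real.isLittleO_log_id_atTop.bound (by positivity)
  obtain ⟨x, hx, hx3, hxC⟩ := (h1.and ((eventually_ge_atTop 3).and
    (eventually_gt_atTop ((C + 3 * κ / 2) / (κ / 4))))).exists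
  rw [div_lt_iff₀ (by positivity)] at hxC
  rw [id, Real.norm_of_nonneg (by linarith : (0 : ℝ) ≤ x)] at hx
  have h2 := (le_abs_self _).trans hx
  refine ⟨x - 1, by linarith, ?_⟩
  rw [add_sub_cancel]
  nlinarith

/-- The curvature of the circle `|z| = |z₀|` is negligible on a disc of radius `t ρ` when
`t² ρ ≤ |z₀|`: up to `ρ`, the radial coordinate is the linear coordinate in the direction `z₀`. -/
lemma abs_norm_sub_norm_le_of_strip {z₀ z ω : ℂ} {ρ t : ℝ} (hω : ‖ω‖ = 1)
    (hz₀ : z₀ * (starRingEnd ℂ) ω = ‖z₀‖) (hρ : 0 < ρ) (ht : 2 ≤ t) (hfar : t ^ 2 * ρ ≤ ‖z₀‖)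
    (hz : ‖z - z₀‖ ≤ t * ρ) :
    |‖z‖ - ‖z₀‖| ≤ ρ * (|((z - z₀) * (starRingEnd ℂ) ω).re / ρ| + 1) := by
  set p := (z - z₀) * (starRingEnd ℂ) ω with hp
  have hpn : ‖p‖ ≤ t * ρ := by rw [hp, norm_mul, RCLike.norm_conj, hω, mul_one]; exact hz
  have hq : ‖z‖ = ‖(‖z₀‖ : ℂ) + p‖ := by
    rw [← hz₀, hp, ← add_mul, norm_mul, RCLike.norm_conj, hω, mul_one]
    congr 1; ring
  have hx : ρ * (|p.re / ρ| + 1) = |p.re| + ρ := by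
    rw [abs_div, abs_of_pos hρ]; field_simp
  have hre : |p.re| ≤ t * ρ := (Complex.abs_re_le_norm p).trans hpn
  have him : |p.im| ≤ t * ρ := (Complex.abs_im_le_norm p).trans hpn
  have hlow : ‖z₀‖ + p.re ≤ ‖z‖ := by
    rw [hq]
    simpa using Complex.re_le_norm ((‖z₀‖ : ℂ) + p)
  have hhalf : t * ρ ≤ ‖z₀‖ / 2 := by
    nlinarith [mul_nonneg (sub_nonneg.2 ht) (mul_nonneg (by linarith : (0 : ℝ) ≤ t) hρ.le)]
  have hup : ‖z‖ ≤ ‖z₀‖ + p.re + ρ := by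
    refine abs_le_of_sq_le_sq' ?_ ?_ |>.2
    · rw [hq, Complex.sq_norm, Complex.normSq_apply]
      simp only [Complex.add_re, Complex.ofReal_re, Complex.add_im, Complex.ofReal_im, zero_add]
      have h1 : p.im ^ 2 ≤ (t * ρ) ^ 2 := sq_le_sq' (by linarith [(abs_le.1 him).1]) (abs_le.1 him).2
      have h2 : (t * ρ) ^ 2 ≤ ‖z₀‖ * ρ := by nlinarith
      have h3 := (abs_le.1 hre).1
      nlinarith
    · linarith [(abs_le.1 hre).1, norm_nonneg z₀]
  rw [hx, abs_le]
  constructor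
  · linarith [neg_abs_le p.re]
  · linarith [le_abs_self p.re]

/-- Zeros of functions of class `𝒮_γ` come with bounded gaps, measured on the scale `ρ`. On a
zero-free disc of radius `2tρ` about `z₀` the function `φ - log |S|` is subharmonic, with Laplacian
of order `ρ⁻²` on a strip of length `tρ`, hence exceeds its central value by a multiple of `t` at
some point of the circle of radius `tρ`; the two-sided estimate for `|S|` allows only an excess of
order `log t`, because `ρ` grows at most linearly. -/
theorem InClassS.exists_infDist_le {φ : ℝ → ℝ} {γ : ℝ} {S : ℂ → ℂ} (hφ : IsFockWeight φ)
    (hS : InClassS φ γ S) (hne : (zeroSet S).Nonempty) :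
    ∃ C : ℝ, 0 < C ∧ ∀ z, Metric.infDist z (zeroSet S) ≤ C * rho φ z := by
  obtain ⟨c, K, hc, hK, -, hlin⟩ := hφ.exists_rho_bounds
  obtain ⟨M, hM, hcmp⟩ := hS.comparable
  obtain ⟨l, hl⟩ := hne
  set K₁ := K + 1 / c with hK₁
  have hK₁0 : 0 < K₁ := by positivity
  set κ := 1 / (4 * K₁ ^ 2) with hκ
  have hκ0 : 0 < κ := by positivity
  obtain ⟨t, ht, htC⟩ := exists_linear_gt_log hκ0
    (2 * Real.log M + Real.log 2 + Real.log K₁ + |γ| * Real.log 2)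
  have ht0 : 0 < t := by linarith
  have hρ0 := hφ.rho_pos 0
  refine ⟨2 * t + t ^ 2 + ‖l‖ / rho φ 0 * (K + t ^ 2 / c), by positivity, fun z₀ => ?_⟩
  set ρ := rho φ z₀ with hρdef
  have hρ : 0 < ρ := hφ.rho_pos z₀
  set d := Metric.infDist z₀ (zeroSet S) with hd
  -- the last two terms of the constant deal with the points where `|z₀| < t ^ 2 * ρ`
  by_contra! hcon
  have hextra : 0 ≤ ‖l‖ / rho φ 0 * (K + t ^ 2 / c) := by positivity
  have hdt : 2 * t * ρ ≤ d := by
    refine le_trans ?_ hcon.le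
    gcongr
    nlinarith
  have hfar : t ^ 2 * ρ ≤ ‖z₀‖ := by
    by_contra! hnear
    have h1 : d ≤ ‖z₀‖ + ‖l‖ := (Metric.infDist_le_dist_of_mem hl).trans (by
      rw [dist_eq_norm]; exact norm_sub_le _ _)
    have h2 : rho φ 0 ≤ (K + t ^ 2 / c) * ρ := by
      have h3 := hlin z₀ 0
      rw [norm_zero, zero_sub, abs_neg, abs_norm, ← hρdef] at h3
      calc _ ≤ K * ρ + t ^ 2 * ρ / c := h3.trans (by gcongr)
        _ = _ := by ring
    have h3 : ‖l‖ ≤ ‖l‖ / rho φ 0 * (K + t ^ 2 / c) * ρ := by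
      calc ‖l‖ = ‖l‖ / rho φ 0 * rho φ 0 := by field_simp
        _ ≤ ‖l‖ / rho φ 0 * ((K + t ^ 2 / c) * ρ) := by gcongr
        _ = _ := by ring
    have h4 : 0 ≤ 2 * t * ρ := by positivity
    nlinarith
  have hz₀ : 0 < ‖z₀‖ := lt_of_lt_of_le (by positivity) hfar
  have hhalf : t * ρ ≤ ‖z₀‖ / 2 := by nlinarith
  set ω := z₀ / ‖z₀‖ with hωdef
  have hω : ‖ω‖ = 1 := by
    rw [hωdef, norm_div, Complex.norm_real, norm_norm, div_self hz₀.ne']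
  have hωz : z₀ * (starRingEnd ℂ) ω = ‖z₀‖ := by
    have : (‖z₀‖ : ℂ) ≠ 0 := by exact_mod_cast hz₀.ne'
    rw [hωdef, map_div₀, Complex.conj_ofReal, mul_div_assoc', Complex.mul_conj, Complex.normSq_eq_norm_sq]
    field_simp
    push_cast
    rfl
  -- `ρ` and the distance to the zero set on the disc
  have hρz : ∀ z, ‖z - z₀‖ ≤ t * ρ →
      rho φ z ≤ K₁ * ρ * (1 + |((z - z₀) * (starRingEnd ℂ) ω).re / ρ|) := by
    intro z hz
    have h1 := abs_norm_sub_norm_le_of_strip hω hωz hρ ht hfar hz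
    set x := ((z - z₀) * (starRingEnd ℂ) ω).re / ρ
    calc rho φ z ≤ K * ρ + ρ * (|x| + 1) / c := (hlin z₀ z).trans (by gcongr)
      _ ≤ K * ρ * (1 + |x|) + ρ * (|x| + 1) / c := by
          have : K * ρ ≤ K * ρ * (1 + |x|) :=
            le_mul_of_one_le_right (by positivity) (by linarith [abs_nonneg x])
          linarith
      _ = _ := by rw [hK₁]; ring
  have hdz : ∀ z, ‖z - z₀‖ ≤ t * ρ → d / 2 ≤ Metric.infDist z (zeroSet S) := by
    intro z hz
    have h1 : d ≤ Metric.infDist z (zeroSet S) + dist z₀ z := Metric.infDist_le_infDist_add_dist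
    rw [dist_comm, dist_eq_norm] at h1
    linarith
  have hd0 : 0 < d := lt_of_lt_of_le (by positivity) hdt
  have hSz : ∀ z, ‖z - z₀‖ ≤ t * ρ → S z ≠ 0 := by
    intro z hz h0
    have h1 : Metric.infDist z (zeroSet S) = 0 := Metric.infDist_zero_of_mem h0
    have h2 := hdz z hz
    linarith
  obtain ⟨z, hz, hW⟩ := exists_sphere_add_le (W := fun z => φ ‖z‖ - Real.log ‖S z‖)
    hω hρ ht0 hκ0 (fun z hz => by
      rw [Metric.mem_closedBall, dist_eq_norm] at hz
      exact hφ.contDiff.contDiffAt.sub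
        ((hS.entire.analyticAt z).harmonicAt_log_norm (hSz z hz)).1) (fun z hz => by
      rw [Metric.mem_closedBall, dist_eq_norm] at hz
      have hh := (hS.entire.analyticAt z).harmonicAt_log_norm (hSz z hz)
      have h1 := hφ.contDiff.contDiffAt.laplacian_sub (x := z) hh.1
      have h2 : Laplacian.laplacian (fun z => Real.log ‖S z‖) z = 0 := hh.2.self_of_nhds
      rw [h2, sub_zero, hφ.laplacian_eq] at h1
      have h3 := hρz z hz
      set x := ((z - z₀) * (starRingEnd ℂ) ω).re / ρ with hx
      have h4 : Laplacian.laplacian (fun z => φ ‖z‖ - Real.log ‖S z‖) z = (rho φ z ^ 2)⁻¹ := h1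
      rw [h4]
      have hρz0 := hφ.rho_pos z
      have h5 : rho φ z ^ 2 ≤ 2 * K₁ ^ 2 * ρ ^ 2 * (1 + x ^ 2) := by
        calc rho φ z ^ 2 ≤ (K₁ * ρ * (1 + |x|)) ^ 2 := by gcongr
          _ = K₁ ^ 2 * ρ ^ 2 * (1 + |x|) ^ 2 := by ring
          _ ≤ K₁ ^ 2 * ρ ^ 2 * (2 * (1 + x ^ 2)) := by
              gcongr
              nlinarith [sq_nonneg (1 - |x|), sq_abs x]
          _ = _ := by ring
      have hx2 : 0 < 1 + x ^ 2 := by positivity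
      calc κ / (ρ ^ 2 * (1 + x ^ 2)) < 2 * κ / (ρ ^ 2 * (1 + x ^ 2)) := by
            gcongr; linarith
        _ = (2 * K₁ ^ 2 * ρ ^ 2 * (1 + x ^ 2))⁻¹ := by rw [hκ]; field_simp; norm_num
        _ ≤ _ := by gcongr)
  rw [mem_sphere_iff_norm] at hz
  have hrz := hφ.rho_pos z
  have hdz' := hdz z hz.le
  have hdz0 : 0 < Metric.infDist z (zeroSet S) := by linarith
  have hn0 : 0 < 1 + ‖z₀‖ := by positivity
  have hn : 0 < 1 + ‖z‖ := by positivity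
  -- logarithms of the two-sided estimate at `z₀` and at `z`
  have hlogv : ∀ y : ℂ, 0 < Metric.infDist y (zeroSet S) →
      Real.log (Real.exp (φ ‖y‖) * (Metric.infDist y (zeroSet S) / rho φ y) * (1 / (1 + ‖y‖) ^ γ))
      = φ ‖y‖ + (Real.log (Metric.infDist y (zeroSet S)) - Real.log (rho φ y)) -
        γ * Real.log (1 + ‖y‖) := by
    intro y hy
    have h1 := hφ.rho_pos y
    have h2 : 0 < (1 + ‖y‖) ^ γ := by positivity
    rw [Real.log_mul (by positivity) (by positivity), Real.log_mul (by positivity) (by positivity),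
      Real.log_exp, Real.log_div hy.ne' h1.ne', one_div, Real.log_inv, Real.log_rpow (by positivity)]
    ring
  have hvpos : ∀ y : ℂ, 0 < Metric.infDist y (zeroSet S) →
      0 < Real.exp (φ ‖y‖) * (Metric.infDist y (zeroSet S) / rho φ y) * (1 / (1 + ‖y‖) ^ γ) := by
    intro y hy
    have h1 := hφ.rho_pos y
    positivity
  have hS0 : 0 < ‖S z₀‖ := norm_pos_iff.2 (hSz z₀ (by simp; positivity))
  have hS1 : 0 < ‖S z‖ := norm_pos_iff.2 (hSz z hz.le)
  have u0 := Real.log_le_log hS0 (hcmp z₀ trivial).1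
  rw [Real.log_mul hM.ne' (hvpos z₀ hd0).ne', hlogv z₀ hd0] at u0
  have u1 := Real.log_le_log (hvpos z hdz0) (hcmp z trivial).2
  rw [Real.log_mul hM.ne' hS1.ne', hlogv z hdz0] at u1
  have u2 := Real.log_le_log (by positivity) hdz'
  rw [Real.log_div hd0.ne' two_ne_zero] at u2
  have u3 : Real.log (rho φ z) ≤ Real.log K₁ + Real.log ρ + Real.log (1 + t) := by
    rw [← Real.log_mul hK₁0.ne' hρ.ne', ← Real.log_mul (by positivity) (by positivity)]
    refine Real.log_le_log hrz ((hρz z hz.le).trans ?_)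
    gcongr
    rw [abs_div, abs_of_pos hρ, div_le_iff₀ hρ, ← hz]
    refine (Complex.abs_re_le_norm _).trans ?_
    rw [norm_mul, RCLike.norm_conj, hω, mul_one]
  have hzn := abs_le.1 ((abs_norm_sub_norm_le z z₀).trans_eq hz)
  have u4 : γ * Real.log (1 + ‖z‖) - γ * Real.log (1 + ‖z₀‖) ≤ |γ| * Real.log 2 := by
    rw [← mul_sub]
    refine (le_abs_self _).trans ?_
    rw [abs_mul]
    gcongr
    rw [abs_le]
    constructor
    · have := Real.log_le_log hn0 (show 1 + ‖z₀‖ ≤ 2 * (1 + ‖z‖) by linarith [hzn.1])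
      rw [Real.log_mul two_ne_zero hn.ne'] at this
      linarith
    · have := Real.log_le_log hn (show 1 + ‖z‖ ≤ 2 * (1 + ‖z₀‖) by linarith [hzn.2])
      rw [Real.log_mul two_ne_zero hn0.ne'] at this
      linarith
  linarith

/-! ### The zeros of a function of class `𝒮_γ` -/

lemma eventually_ne_zero_of_countable_zeroSet {S : ℂ → ℂ} (hS : Differentiable ℂ S)
    (hc : (zeroSet S).Countable) (z : ℂ) : ∀ᶠ w in 𝓝[≠] z, S w ≠ 0 := by
  have han : AnalyticOnNhd ℂ S Set.univ := fun w _ => hS.analyticAt w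
  rcases (hS.analyticAt z).eventually_eq_zero_or_eventually_ne_zero with h | h
  · exfalso
    have h0 : Set.EqOn S 0 Set.univ :=
      han.eqOn_zero_of_preconnected_of_eventuallyEq_zero isPreconnected_univ (Set.mem_univ z) h
    have : zeroSet S = Set.univ := Set.eq_univ_of_forall fun w => h0 (Set.mem_univ w)
    rw [this] at hc
    exact not_countable_complex hc
  · exact h

lemma IsOrderedEnumeration.countable {Λ : Set ℂ} {lam : ℕ → ℂ}
    (h : IsOrderedEnumeration Λ lam) : Λ.Countable := h.range_eq ▸ Set.countable_range lam

lemma finite_zeroSet_inter_closedBall {S : ℂ → ℂ} (hS : Differentiable ℂ S)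
    (hc : (zeroSet S).Countable) (R : ℝ) : {z ∈ zeroSet S | ‖z‖ ≤ R}.Finite := by
  by_contra hinf
  obtain ⟨z, -, hz⟩ := Set.Infinite.exists_accPt_of_subset_isCompact hinf
    (isCompact_closedBall (0 : ℂ) R) (fun z hz => by simpa using hz.2)
  rw [accPt_iff_frequently_nhdsNE] at hz
  exact hz ((eventually_ne_zero_of_countable_zeroSet hS hc z).mono fun w hw h => hw h.1)

lemma IsOrderedEnumeration.tendsto_norm {S : ℂ → ℂ} {lam : ℕ → ℂ} (hS : Differentiable ℂ S)
    (h : IsOrderedEnumeration (zeroSet S) lam) : Tendsto (fun k => ‖lam k‖) atTop atTop := by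
  refine tendsto_atTop_atTop_of_monotone h.monotone_norm fun b => ?_
  by_contra! hb
  refine Set.infinite_range_of_injective h.injective
    ((finite_zeroSet_inter_closedBall hS h.countable b).subset ?_)
  rintro _ ⟨k, rfl⟩
  exact ⟨h.range_eq ▸ Set.mem_range_self k, (hb k).le⟩

/-- The zeros are simple, by the lower bound for `|S|` near them. -/
lemma InClassS.deriv_ne_zero {φ : ℝ → ℝ} {γ : ℝ} {S : ℂ → ℂ} (hφ : IsFockWeight φ)
    (hS : InClassS φ γ S) (hc : (zeroSet S).Countable) {l : ℂ} (hl : l ∈ zeroSet S) :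
    deriv S l ≠ 0 := by
  intro h0
  obtain ⟨M, hM, hcmp⟩ := hS.comparable
  have hSl : S l = 0 := hl
  set g : ℂ → ℝ := fun z => Real.exp (φ ‖z‖) * (1 / rho φ z) * (1 / (1 + ‖z‖) ^ γ) with hg
  have hgc : Continuous g := by
    have h1 : Continuous fun z : ℂ => φ ‖z‖ := hφ.contDiff.continuous
    have h2 := hφ.continuous_rho
    have h3 : Continuous fun z : ℂ => (1 + ‖z‖) ^ γ :=
      Continuous.rpow_const (by fun_prop) fun z => Or.inl (by positivity)
    refine Continuous.mul (Continuous.mul (Real.continuous_exp.comp h1) ?_) ?_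
    · exact continuous_const.div h2 fun z => (hφ.rho_pos z).ne'
    · exact continuous_const.div h3 fun z => by positivity
  have hgl : 0 < g l := by
    have := hφ.rho_pos l
    positivity
  have hne := eventually_ne_zero_of_countable_zeroSet hS.entire hc l
  obtain ⟨ε, hε, hball⟩ := Metric.mem_nhdsWithin_iff.1 hne
  have hdist : ∀ z ∈ Metric.ball l (ε / 2), ‖z - l‖ ≤ Metric.infDist z (zeroSet S) := by
    intro z hz
    rw [Metric.le_infDist ⟨l, hl⟩]
    intro y hy
    rcases eq_or_ne y l with rfl | hyl
    · rw [dist_eq_norm]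
    have hy1 : ε ≤ dist y l := by
      by_contra! hlt
      exact hball ⟨hlt, hyl⟩ hy
    have h2 := dist_triangle y z l
    rw [Metric.mem_ball] at hz
    rw [← dist_eq_norm, dist_comm z y]
    linarith
  have hd : HasDerivAt S 0 l := h0 ▸ (hS.entire l).hasDerivAt
  have hlittle := hd.isLittleO
  simp only [hSl, sub_zero, smul_zero] at hlittle
  have h1 := hlittle.bound (show 0 < g l / (2 * M) / 2 by positivity)
  have h2 : ∀ᶠ z in 𝓝 l, g l / 2 < g z :=
    hgc.continuousAt.eventually (lt_mem_nhds (by linarith))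
  have h3 : ∀ᶠ z in 𝓝[≠] l, False := by
    filter_upwards [nhdsWithin_le_nhds h1, nhdsWithin_le_nhds h2,
      nhdsWithin_le_nhds (Metric.ball_mem_nhds l (half_pos hε)), self_mem_nhdsWithin]
      with z hz1 hz2 hz3 hz4
    have hzl : 0 < ‖z - l‖ := norm_pos_iff.2 (sub_ne_zero.2 hz4)
    have h4 : Real.exp (φ ‖z‖) * (Metric.infDist z (zeroSet S) / rho φ z) *
      (1 / (1 + ‖z‖) ^ γ) ≤ M * ‖S z‖ := (hcmp z trivial).2
    have h5 : g z * ‖z - l‖ ≤ M * ‖S z‖ := by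
      refine le_trans ?_ h4
      have := hφ.rho_pos z
      calc g z * ‖z - l‖ = Real.exp (φ ‖z‖) * (‖z - l‖ / rho φ z) *
            (1 / (1 + ‖z‖) ^ γ) := by rw [hg]; ring
        _ ≤ _ := by gcongr; exact hdist z hz3
    have h6 : M * ‖S z‖ ≤ g l / 4 * ‖z - l‖ := by
      calc M * ‖S z‖ ≤ M * (g l / (2 * M) / 2 * ‖z - l‖) := by gcongr
        _ = _ := by field_simp; norm_num
    nlinarith
  obtain ⟨_, h⟩ := h3.exists
  exact h

/-! ### Cutoff functions -/

lemma exists_smoothTransition_lipschitz :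
    ∃ B : ℝ, 0 < B ∧ ∀ x, |deriv Real.smoothTransition x| ≤ B := by
  have hc : Continuous (deriv Real.smoothTransition) :=
    (Real.smoothTransition.contDiff (n := 1)).continuous_deriv le_rfl
  obtain ⟨B, hB⟩ := (isCompact_Icc (a := (0 : ℝ)) (b := 1)).exists_bound_of_continuousOn
    hc.continuousOn
  refine ⟨max B 1, by positivity, fun x => ?_⟩
  by_cases hx : x ∈ Set.Icc (0 : ℝ) 1
  · exact (hB x hx).trans (le_max_left _ _)
  have h0 : deriv Real.smoothTransition x = 0 := by
    rw [Set.mem_Icc, not_and_or, not_le, not_le] at hx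
    rcases hx with hx | hx
    · have : Real.smoothTransition =ᶠ[𝓝 x] fun _ => 0 := by
        filter_upwards [gt_mem_nhds hx] with y hy
        exact Real.smoothTransition.zero_of_nonpos hy.le
      rw [this.deriv_eq]; simp
    · have : Real.smoothTransition =ᶠ[𝓝 x] fun _ => 1 := by
        filter_upwards [lt_mem_nhds hx] with y hy
        exact Real.smoothTransition.one_of_one_le hy.le
      rw [this.deriv_eq]; simp
  rw [h0, abs_zero]
  positivity

/-- A smooth function that is `1` on the disc of radius `a` and `0` off the disc of radius `b`
about `p`; it depends on `‖z - p‖ ^ 2`, which is smooth at the centre too. -/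
noncomputable def discCutoff (p : ℂ) (a b : ℝ) (z : ℂ) : ℝ :=
  Real.smoothTransition ((b ^ 2 - ‖z - p‖ ^ 2) / (b ^ 2 - a ^ 2))

section discCutoff

variable {p : ℂ} {a b : ℝ}

lemma discCutoff_nonneg (z : ℂ) : 0 ≤ discCutoff p a b z := Real.smoothTransition.nonneg _

lemma discCutoff_le_one (z : ℂ) : discCutoff p a b z ≤ 1 := Real.smoothTransition.le_one _

lemma discCutoff_eq_one (ha : 0 ≤ a) (hab : a < b) {z : ℂ} (hz : ‖z - p‖ ≤ a) :
    discCutoff p a b z = 1 := by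
  refine Real.smoothTransition.one_of_one_le ?_
  have : a ^ 2 < b ^ 2 := by gcongr
  rw [one_le_div (by linarith)]
  gcongr

lemma discCutoff_eq_zero (ha : 0 ≤ a) (hab : a < b) {z : ℂ} (hz : b ≤ ‖z - p‖) :
    discCutoff p a b z = 0 := by
  refine Real.smoothTransition.zero_of_nonpos ?_
  have h1 : a ^ 2 < b ^ 2 := by gcongr
  have h2 : b ^ 2 ≤ ‖z - p‖ ^ 2 := by
    have : 0 ≤ b := ha.trans hab.le
    gcongr
  exact div_nonpos_of_nonpos_of_nonneg (by linarith) (by linarith)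

lemma contDiff_discCutoff : ContDiff ℝ 1 (discCutoff p a b) := by
  have h2 : ContDiff ℝ 1 fun z : ℂ => ‖z - p‖ ^ 2 :=
    (contDiff_id.sub contDiff_const).norm_sq ℝ
  exact Real.smoothTransition.contDiff.comp ((contDiff_const.sub h2).div_const _)

lemma norm_fderiv_discCutoff_le {B : ℝ} (hB : ∀ x, |deriv Real.smoothTransition x| ≤ B)
    (ha : 0 ≤ a) (hab : a < b) (z : ℂ) : ‖fderiv ℝ (discCutoff p a b) z‖ ≤ 2 * B / (b - a) := by
  have hb : 0 < b := ha.trans_lt hab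
  have hba : 0 < b - a := sub_pos.2 hab
  have hB0 : 0 ≤ B := (abs_nonneg _).trans (hB 0)
  rcases lt_or_ge b ‖z - p‖ with hz | hz
  · have : discCutoff p a b =ᶠ[𝓝 z] fun _ => 0 := by
      have hc : ContinuousAt (fun z : ℂ => ‖z - p‖) z := by fun_prop
      filter_upwards [hc.eventually (lt_mem_nhds hz)] with y hy
      exact discCutoff_eq_zero ha hab hy.le
    rw [this.fderiv_eq]
    simp
    positivity
  · have h1 : HasFDerivAt (fun z : ℂ => ‖z - p‖ ^ 2) ((2 : ℕ) • innerSL ℝ (z - p) : ℂ →L[ℝ] ℝ) z := by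
      have := (((hasFDerivAt_id (𝕜 := ℝ) z).sub_const p).norm_sq)
      simpa using this
    have hst : HasDerivAt Real.smoothTransition (deriv Real.smoothTransition
        ((b ^ 2 - ‖z - p‖ ^ 2) / (b ^ 2 - a ^ 2))) ((b ^ 2 - ‖z - p‖ ^ 2) / (b ^ 2 - a ^ 2)) :=
      ((Real.smoothTransition.contDiff (n := 1)).differentiable one_ne_zero _).hasDerivAt
    have h2 : HasFDerivAt (fun z : ℂ => (b ^ 2 - ‖z - p‖ ^ 2) / (b ^ 2 - a ^ 2))
        ((b ^ 2 - a ^ 2)⁻¹ • (-((2 : ℕ) • innerSL ℝ (z - p) : ℂ →L[ℝ] ℝ))) z := by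
      have := (h1.const_sub (b ^ 2)).mul_const ((b ^ 2 - a ^ 2)⁻¹)
      simpa [div_eq_mul_inv] using this
    have h3 : HasFDerivAt (discCutoff p a b) _ z := hst.comp_hasFDerivAt z h2
    rw [h3.fderiv]
    have h4 : 0 < b ^ 2 - a ^ 2 := by nlinarith
    rw [norm_smul, norm_smul, norm_neg, Real.norm_eq_abs, Real.norm_eq_abs,
      abs_of_pos (inv_pos.2 h4)]
    have h5 : ‖((2 : ℕ) • innerSL ℝ (z - p) : ℂ →L[ℝ] ℝ)‖ ≤ 2 * b := by
      refine (norm_nsmul_le).trans ?_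
      rw [innerSL_apply_norm]
      push_cast
      gcongr
    calc _ ≤ B * ((b ^ 2 - a ^ 2)⁻¹ * (2 * b)) := by gcongr; exact hB _
      _ = 2 * B / (b - a) * (b / (b + a)) := by
          have : b ^ 2 - a ^ 2 = (b - a) * (b + a) := by ring
          rw [this]
          field_simp
      _ ≤ 2 * B / (b - a) * 1 := by
          gcongr
          rw [div_le_one (by linarith)]
          linarith
      _ = _ := mul_one _

end discCutoff

/-- A cutoff at radius `R` that takes a prescribed value in `{0, 1}` near each point of a set `Λ`,
where the value is `1` inside and `0` outside the circle `|z| = R`, and is free on that circle. A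
radial cutoff is corrected by disjoint bumps around the points of `Λ` near the circle. -/
theorem exists_cutoff : ∃ B : ℝ, 0 < B ∧ ∀ (R w δ : ℝ) (Λ : Set ℂ) (c : ℂ → ℝ),
    0 ≤ R → 0 < δ → 4 * δ ≤ w → {z ∈ Λ | ‖z‖ ≤ R + 2 * w}.Finite →
    (∀ z ∈ Λ, ∀ z' ∈ Λ, z ≠ z' → ‖z‖ ∈ Set.Icc (R - w) (R + 2 * w) →
      ‖z'‖ ∈ Set.Icc (R - w) (R + 2 * w) → 6 * δ ≤ ‖z - z'‖) →
    (∀ z ∈ Λ, (c z = 1 ∧ ‖z‖ ≤ R) ∨ (c z = 0 ∧ R ≤ ‖z‖)) →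
    ∃ χ : ℂ → ℝ, ContDiff ℝ 1 χ ∧ (∀ z, 0 ≤ χ z ∧ χ z ≤ 1) ∧
      (∀ z, ‖z‖ ≤ R - 2 * δ → χ z = 1) ∧ (∀ z, R + w ≤ ‖z‖ → χ z = 0) ∧
      (∀ l ∈ Λ, ∀ z ∈ Metric.ball l δ, χ z = c l) ∧ ∀ z, ‖fderiv ℝ χ z‖ ≤ B / δ := by
  obtain ⟨B, hB0, hB⟩ := exists_smoothTransition_lipschitz
  refine ⟨4 * B, by positivity, fun R w δ Λ c hR hδ hw hfin hsep hc => ?_⟩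
  have hw0 : 0 < w := by linarith
  set F : Finset ℂ := (hfin.subset (t := {z ∈ Λ | ‖z‖ ∈ Set.Icc (R - w) (R + 2 * w)})
    (fun z hz => ⟨hz.1, hz.2.2⟩)).toFinset with hF
  have hFmem : ∀ z, z ∈ F ↔ z ∈ Λ ∧ ‖z‖ ∈ Set.Icc (R - w) (R + 2 * w) := fun z => by
    rw [hF, Set.Finite.mem_toFinset, Set.mem_ofPred_eq]
  set χ₀ : ℂ → ℝ := discCutoff 0 R (R + w) with hχ₀
  set η : ℂ → ℂ → ℝ := fun l => discCutoff l δ (2 * δ) with hη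
  set χ : ℂ → ℝ := fun z => χ₀ z + ∑ l ∈ F, (c l - χ₀ z) * η l z with hχ
  have hχ₀1 : ∀ z, ‖z‖ ≤ R → χ₀ z = 1 := fun z hz =>
    discCutoff_eq_one hR (by linarith) (by simpa using hz)
  have hχ₀0 : ∀ z, R + w ≤ ‖z‖ → χ₀ z = 0 := fun z hz =>
    discCutoff_eq_zero hR (by linarith) (by simpa using hz)
  have hη1 : ∀ l z, ‖z - l‖ ≤ δ → η l z = 1 := fun l z hz =>
    discCutoff_eq_one hδ.le (by linarith) hz
  have hη0 : ∀ l z, 2 * δ ≤ ‖z - l‖ → η l z = 0 := fun l z hz =>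
    discCutoff_eq_zero hδ.le (by linarith) hz
  have hχd : ContDiff ℝ 1 χ := by
    refine contDiff_discCutoff.add (ContDiff.sum fun l _ => ?_)
    exact (contDiff_const.sub contDiff_discCutoff).mul contDiff_discCutoff
  -- near each point of the plane at most one of the bumps is active
  have hone : ∀ l ∈ F, ∀ z, ‖z - l‖ < 3 * δ → χ z = χ₀ z + (c l - χ₀ z) * η l z := by
    intro l hl z hz
    simp only [hχ]
    rw [Finset.sum_eq_single l]
    · intro l' hl' hne
      rw [hη0 l' z, mul_zero]
      rw [hFmem] at hl hl'
      have h1 := hsep l hl.1 l' hl'.1 hne.symm hl.2 hl'.2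
      have h2 : ‖l - l'‖ ≤ ‖z - l‖ + ‖z - l'‖ := by
        rw [← norm_neg (z - l), neg_sub]
        simpa using norm_add_le (l - z) (z - l')
      linarith
    · intro h; exact absurd hl h
  have hnone : ∀ z, (∀ l ∈ F, 2 * δ ≤ ‖z - l‖) → χ z = χ₀ z := by
    intro z hz
    simp only [hχ]
    rw [Finset.sum_eq_zero, add_zero]
    intro l hl
    rw [hη0 l z (hz l hl), mul_zero]
  have hcases : ∀ z, (∃ l ∈ F, ‖z - l‖ < 3 * δ) ∨ (∀ l ∈ F, 3 * δ ≤ ‖z - l‖) := by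
    intro z
    by_cases h : ∃ l ∈ F, ‖z - l‖ < 3 * δ
    · exact Or.inl h
    · push Not at h
      exact Or.inr h
  have hχin : ∀ z, ‖z‖ ≤ R - 2 * δ → χ z = 1 := by
    intro z hz
    have h1 : χ₀ z = 1 := hχ₀1 z (by linarith)
    rcases hcases z with ⟨l, hl, hzl⟩ | hz'
    · rw [hone l hl z hzl, h1]
      rcases hc l ((hFmem l).1 hl).1 with hcl | hcl
      · rw [hcl.1]; ring
      · rw [hη0 l z, mul_zero, add_zero]
        have := norm_sub_norm_le l z
        rw [norm_sub_rev] at this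
        linarith [hcl.2]
    · rw [hnone z fun l hl => by linarith [hz' l hl], h1]
  have hχout : ∀ z, R + w ≤ ‖z‖ → χ z = 0 := by
    intro z hz
    have h1 : χ₀ z = 0 := hχ₀0 z hz
    rcases hcases z with ⟨l, hl, hzl⟩ | hz'
    · rw [hone l hl z hzl, h1]
      rcases hc l ((hFmem l).1 hl).1 with hcl | hcl
      · rw [hη0 l z, mul_zero, add_zero]
        have := norm_sub_norm_le z l
        linarith [hcl.2]
      · rw [hcl.1]; ring
    · rw [hnone z fun l hl => by linarith [hz' l hl], h1]
  refine ⟨χ, hχd, fun z => ?_, hχin, hχout, fun l hl z hz => ?_, fun z => ?_⟩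
  · have h0 : 0 ≤ χ₀ z := discCutoff_nonneg z
    have h1 : χ₀ z ≤ 1 := discCutoff_le_one z
    rcases hcases z with ⟨l, hl, hz⟩ | hz
    · rw [hone l hl z hz]
      have h2 : 0 ≤ η l z := discCutoff_nonneg z
      have h3 : η l z ≤ 1 := discCutoff_le_one z
      rcases hc l ((hFmem l).1 hl).1 with hcl | hcl <;> rw [hcl.1] <;> constructor <;> nlinarith
    · rw [hnone z fun l hl => by linarith [hz l hl]]
      exact ⟨h0, h1⟩
  · rw [Metric.mem_ball, dist_eq_norm] at hz
    by_cases hlF : l ∈ F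
    · rw [hone l hlF z (by linarith), hη1 l z hz.le]; ring
    have hzl := abs_le.1 (abs_norm_sub_norm_le z l)
    rw [hFmem, Set.mem_Icc, not_and, not_and_or, not_le, not_le] at hlF
    rcases hlF hl with hlt | hgt
    · rw [hχin z (by linarith)]
      rcases hc l hl with hcl | hcl
      · exact hcl.1.symm
      · linarith [hcl.2]
    · rw [hχout z (by linarith)]
      rcases hc l hl with hcl | hcl
      · linarith [hcl.2]
      · exact hcl.1.symm
  · have hd0 : DifferentiableAt ℝ χ₀ z := contDiff_discCutoff.differentiable one_ne_zero z
    have hb0 : ‖fderiv ℝ χ₀ z‖ ≤ 2 * B / δ := by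
      refine (norm_fderiv_discCutoff_le hB hR (by linarith) z).trans ?_
      gcongr
      linarith
    rcases hcases z with ⟨l, hl, hz⟩ | hz
    · have hev : χ =ᶠ[𝓝 z] fun y => χ₀ y + (c l - χ₀ y) * η l y := by
        have hcont : ContinuousAt (fun z : ℂ => ‖z - l‖) z := by fun_prop
        filter_upwards [hcont.eventually (gt_mem_nhds hz)] with y hy using hone l hl y hy
      have hdη : DifferentiableAt ℝ (η l) z := contDiff_discCutoff.differentiable one_ne_zero z
      have hbη : ‖fderiv ℝ (η l) z‖ ≤ 2 * B / δ := by
        refine (norm_fderiv_discCutoff_le hB hδ.le (by linarith) z).trans_eq ?_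
        congr 1; ring
      have hfd : HasFDerivAt (fun y => χ₀ y + (c l - χ₀ y) * η l y)
          ((1 - η l z) • fderiv ℝ χ₀ z + (c l - χ₀ z) • fderiv ℝ (η l) z) z := by
        have := hd0.hasFDerivAt.add ((hd0.hasFDerivAt.const_sub (c l)).mul hdη.hasFDerivAt)
        refine this.congr_fderiv ?_
        ext v
        simp
        ring
      rw [hev.fderiv_eq, hfd.fderiv]
      have h0 : 0 ≤ χ₀ z := discCutoff_nonneg z
      have h1 : χ₀ z ≤ 1 := discCutoff_le_one z
      have h2 : 0 ≤ η l z := discCutoff_nonneg z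
      have h3 : η l z ≤ 1 := discCutoff_le_one z
      have h4 : |1 - η l z| ≤ 1 := by rw [abs_le]; constructor <;> linarith
      have h5 : |c l - χ₀ z| ≤ 1 := by
        rcases hc l ((hFmem l).1 hl).1 with hcl | hcl <;> rw [hcl.1, abs_le] <;>
          constructor <;> linarith
      refine (norm_add_le _ _).trans ?_
      rw [norm_smul, norm_smul, Real.norm_eq_abs, Real.norm_eq_abs]
      calc _ ≤ 1 * (2 * B / δ) + 1 * (2 * B / δ) := by gcongr
        _ = _ := by ring
    · have hev : χ =ᶠ[𝓝 z] χ₀ := by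
        have : ∀ᶠ y in 𝓝 z, ∀ l ∈ F, 2 * δ < ‖y - l‖ := by
          rw [Finset.eventually_all]
          intro l hl
          have hcont : ContinuousAt (fun z : ℂ => ‖z - l‖) z := by fun_prop
          exact hcont.eventually (lt_mem_nhds (by linarith [hz l hl]))
        filter_upwards [this] with y hy using hnone y fun l hl => (hy l hl).le
      rw [hev.fderiv_eq]
      refine hb0.trans ?_
      gcongr
      linarith

/-! ### The remainder of Lagrange interpolation -/

lemma dbarTwist_eq_zero {G : ℂ → ℂ} {z : ℂ} (h : DifferentiableAt ℂ G z) : dbarTwist G z = 0 := by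
  rw [dbarTwist, h.hasDerivAt.complexToReal_fderiv.fderiv]
  simp
  ring

lemma tendsto_div_sub_cocompact (a l : ℂ) :
    Tendsto (fun z : ℂ => a / (z - l)) (cocompact ℂ) (𝓝 0) := by
  rw [← Metric.cobounded_eq_cocompact]
  have h1 : Tendsto (fun z : ℂ => z - l) (Bornology.cobounded ℂ) (Bornology.cobounded ℂ) :=
    tendsto_sub_const_cobounded l
  have := (tendsto_inv₀_cobounded.comp h1).const_mul a
  simpa [div_eq_mul_inv, Function.comp_def] using this

/-- Near a simple zero `l` of `S`, subtracting the principal part makes `f / S` analytic. -/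
lemma exists_analyticAt_div_sub {S f : ℂ → ℂ} (hS : Differentiable ℂ S) (hf : Differentiable ℂ f)
    {l : ℂ} (hl : S l = 0) (hd : deriv S l ≠ 0) :
    ∃ g : ℂ → ℂ, AnalyticAt ℂ g l ∧
      (fun z => f z / S z - f l / (deriv S l * (z - l))) =ᶠ[𝓝[≠] l] g := by
  set s := dslope S l with hs
  have hsd : Differentiable ℂ s := fun z =>
    ((Complex.differentiableOn_dslope (s := Set.univ) univ_mem).2
      hS.differentiableOn).differentiableAt univ_mem
  have hsl : s l = deriv S l := dslope_same _ _
  have hq : AnalyticAt ℂ (fun z => f z / s z) l :=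
    (hf.analyticAt l).div (hsd.analyticAt l) (by rwa [hsl])
  obtain ⟨U, hU, hqU⟩ := hq.eventually_analyticAt.exists_mem
  have hqd : DifferentiableOn ℂ (fun z => f z / s z) (interior U) := fun z hz =>
    (hqU z (interior_subset hz)).differentiableAt.differentiableWithinAt
  have hU' : interior U ∈ 𝓝 l := interior_mem_nhds.2 hU
  refine ⟨dslope (fun z => f z / s z) l, ?_, ?_⟩
  · exact ((Complex.differentiableOn_dslope hU').2 hqd).analyticAt hU'
  · have hsne : ∀ᶠ z in 𝓝 l, s z ≠ 0 :=
      hsd.continuous.continuousAt.eventually_ne (by rwa [hsl])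
    filter_upwards [self_mem_nhdsWithin, nhdsWithin_le_nhds hsne] with z hz hz'
    have hzl : z - l ≠ 0 := sub_ne_zero.2 hz
    have hSz : S z = (z - l) * s z := by
      have := sub_smul_dslope S l z
      rw [hl, sub_zero, smul_eq_mul] at this
      exact this.symm
    rw [dslope_of_ne _ hz, slope_def_field, hsl, hSz]
    field_simp

/-- The remainder of Lagrange interpolation is a cutoff of `f` plus `S` times a smooth function
whose antiholomorphic derivative is `f / S` times that of the cutoff. -/
theorem exists_remainder {S f : ℂ → ℂ} (hS : Differentiable ℂ S) (hf : Differentiable ℂ f)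
    {lam : ℕ → ℂ} (hlam : IsOrderedEnumeration (zeroSet S) lam)
    (hd : ∀ l ∈ zeroSet S, deriv S l ≠ 0) (N : ℕ) {χ : ℂ → ℝ} (hχ : ContDiff ℝ 1 χ) {δ T : ℝ}
    (hδ : 0 < δ) (hnear : ∀ k, ∀ z ∈ Metric.ball (lam k) δ, χ z = if k < N then 1 else 0)
    (hT : ∀ z, T ≤ ‖z‖ → χ z = 0) :
    ∃ G : ℂ → ℂ, ContDiff ℝ 1 G ∧ Tendsto G (cocompact ℂ) (𝓝 0) ∧
      (∀ z, S z ≠ 0 → f z - lagrangePartialSum S lam f N z = (1 - χ z) * f z + S z * G z) ∧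
      ∀ z, dbarTwist G z =
        f z / S z * (Complex.I * fderiv ℝ χ z z - fderiv ℝ χ z (Complex.I * z)) := by
  have hiso := eventually_ne_zero_of_countable_zeroSet hS hlam.countable
  have hz : ∀ k, S (lam k) = 0 := fun k => by
    have : lam k ∈ zeroSet S := hlam.range_eq ▸ Set.mem_range_self k
    exact this
  set P : Finset ℕ → ℂ → ℂ := fun F z => ∑ k ∈ F, f (lam k) / (deriv S (lam k) * (z - lam k))
    with hP
  have hPd : ∀ F : Finset ℕ, ∀ z, (∀ k ∈ F, z ≠ lam k) → AnalyticAt ℂ (P F) z := by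
    intro F z hzF
    simp only [hP]
    refine Finset.analyticAt_fun_sum F fun k hk => ?_
    refine analyticAt_const.div (by fun_prop) ?_
    exact mul_ne_zero (hd _ (hz k)) (sub_ne_zero.2 (hzF k hk))
  set G₀ : ℂ → ℂ := fun z => χ z * (f z / S z) - P (Finset.range N) z with hG₀
  -- the formula defining `G₀` has junk values at the first `N` zeros, its removable singularities
  open Classical in
  set G : ℂ → ℂ := fun z => if ∃ k < N, z = lam k then limUnder (𝓝[≠] z) G₀ else G₀ z with hG
  have hGS : ∀ z, S z ≠ 0 → G z = G₀ z := by
    intro z hSz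
    simp only [hG]
    rw [if_neg]
    rintro ⟨k, -, rfl⟩
    exact hSz (hz k)
  -- at zeros, `G` is holomorphic
  have hzero : ∀ l, S l = 0 → ∃ g : ℂ → ℂ, AnalyticAt ℂ g l ∧ G =ᶠ[𝓝 l] g := by
    intro l hl
    have hl' : l ∈ Set.range lam := by rw [hlam.range_eq]; exact hl
    obtain ⟨m, rfl⟩ := hl'
    have hball := Metric.ball_mem_nhds (lam m) hδ
    by_cases hm : m < N
    · obtain ⟨g, hg, hgeq⟩ := exists_analyticAt_div_sub hS hf hl (hd _ hl)
      have hg' : AnalyticAt ℂ (g - P ((Finset.range N).erase m)) (lam m) := by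
        refine hg.sub (hPd _ _ fun k hk h => ?_)
        exact (Finset.mem_erase.1 hk).1 (hlam.injective h).symm
      have h1 : G₀ =ᶠ[𝓝[≠] (lam m)] g - P ((Finset.range N).erase m) := by
        filter_upwards [hgeq, nhdsWithin_le_nhds hball] with z hz1 hz2
        have h2 : P (Finset.range N) z = f (lam m) / (deriv S (lam m) * (z - lam m)) +
            P ((Finset.range N).erase m) z :=
          (Finset.add_sum_erase _ _ (Finset.mem_range.2 hm)).symm
        simp only [hG₀, Pi.sub_apply]
        rw [h2, ← hz1, hnear m z hz2, if_pos hm]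
        push_cast
        ring
      have h2 : G (lam m) = (g - P ((Finset.range N).erase m)) (lam m) := by
        simp only [hG]
        rw [if_pos ⟨m, hm, rfl⟩]
        refine Tendsto.limUnder_eq (Tendsto.congr' h1.symm ?_)
        exact hg'.continuousAt.tendsto.mono_left nhdsWithin_le_nhds
      refine ⟨_, hg', ?_⟩
      have h3 : ∀ᶠ z in 𝓝[≠] (lam m), G z = (g - P ((Finset.range N).erase m)) z := by
        filter_upwards [h1, hiso (lam m)] with z hz1 hz2
        rw [hGS z hz2, hz1]
      rw [eventually_nhdsWithin_iff] at h3
      filter_upwards [h3] with z hz3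
      by_cases hzm : z = lam m
      · rw [hzm, h2]
      · exact hz3 hzm
    · have hne : ∀ k ∈ Finset.range N, lam m ≠ lam k := by
        intro k hk h
        have := hlam.injective h
        rw [Finset.mem_range] at hk
        omega
      refine ⟨-P (Finset.range N), (hPd _ _ hne).neg, ?_⟩
      have h3 := hiso (lam m)
      rw [eventually_nhdsWithin_iff] at h3
      filter_upwards [h3, hball] with z hz3 hz4
      have h4 : G z = G₀ z := by
        by_cases hzm : z = lam m
        · simp only [hG]
          rw [if_neg]
          rintro ⟨k, hk, hk'⟩
          exact hne k (Finset.mem_range.2 hk) (hzm ▸ hk')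
        · exact hGS z (hz3 hzm)
      rw [h4]
      simp only [hG₀, Pi.neg_apply]
      rw [hnear m z hz4, if_neg hm]
      simp
  -- away from the zeros, `G` is given by the defining formula
  have hχc : ContDiff ℝ 1 fun z => (χ z : ℂ) := Complex.ofRealCLM.contDiff.comp hχ
  have hnz : ∀ z, S z ≠ 0 → G =ᶠ[𝓝 z] G₀ := by
    intro z hSz
    filter_upwards [hS.continuous.continuousAt.eventually_ne hSz] with y hy using hGS y hy
  have hPz : ∀ z, S z ≠ 0 → AnalyticAt ℂ (P (Finset.range N)) z := by
    intro z hSz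
    refine hPd _ _ fun k _ h => hSz (h ▸ hz k)
  have hfS : ∀ z, S z ≠ 0 → AnalyticAt ℂ (fun z => f z / S z) z := fun z hSz =>
    (hf.analyticAt z).div (hS.analyticAt z) hSz
  refine ⟨G, ?_, ?_, ?_, ?_⟩
  · rw [contDiff_iff_contDiffAt]
    intro z
    by_cases hSz : S z = 0
    · obtain ⟨g, hg, hGg⟩ := hzero z hSz
      exact (hg.contDiffAt.restrict_scalars ℝ).congr_of_eventuallyEq hGg
    · refine ContDiffAt.congr_of_eventuallyEq ?_ (hnz z hSz)
      exact (hχc.contDiffAt.mul ((hfS z hSz).contDiffAt.restrict_scalars ℝ)).sub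
        ((hPz z hSz).contDiffAt.restrict_scalars ℝ)
  · have hPt : Tendsto (P (Finset.range N)) (cocompact ℂ) (𝓝 0) := by
      have := tendsto_finsetSum (Finset.range N) fun k _ =>
        tendsto_div_sub_cocompact (f (lam k) / deriv S (lam k)) (lam k)
      simpa [hP, div_div] using this
    have hPt' : Tendsto (fun z => -P (Finset.range N) z) (cocompact ℂ) (𝓝 0) := by
      simpa using hPt.neg
    refine hPt'.congr' ?_
    have hfar : ∀ᶠ z : ℂ in cocompact ℂ, max T (∑ k ∈ Finset.range N, ‖lam k‖ + 1) ≤ ‖z‖ :=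
      tendsto_norm_cocompact_atTop.eventually (eventually_ge_atTop _)
    filter_upwards [hfar] with z hzf
    have h1 : ¬ ∃ k < N, z = lam k := by
      rintro ⟨k, hk, rfl⟩
      have h2 := Finset.single_le_sum (f := fun k => ‖lam k‖) (fun _ _ => norm_nonneg _)
        (Finset.mem_range.2 hk)
      have h3 := (le_max_right _ _).trans hzf
      linarith
    simp only [hG]
    rw [if_neg h1]
    simp only [hG₀]
    rw [hT z ((le_max_left _ _).trans hzf)]
    simp
  · intro z hSz
    rw [hGS z hSz]
    simp only [hG₀, lagrangePartialSum, hP]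
    field_simp
    ring
  · intro z
    by_cases hSz : S z = 0
    · obtain ⟨g, hg, hGg⟩ := hzero z hSz
      have hGd : DifferentiableAt ℂ G z := hg.differentiableAt.congr_of_eventuallyEq hGg
      rw [dbarTwist_eq_zero hGd, hSz, div_zero, zero_mul]
    · have h1 : HasFDerivAt G₀ ((χ z : ℂ) • (deriv (fun z => f z / S z) z • (1 : ℂ →L[ℝ] ℂ)) +
          (f z / S z) • (Complex.ofRealCLM.comp (fderiv ℝ χ z)) -
          deriv (P (Finset.range N)) z • (1 : ℂ →L[ℝ] ℂ)) z := by
        have ha : HasFDerivAt (fun z => (χ z : ℂ)) (Complex.ofRealCLM.comp (fderiv ℝ χ z)) z :=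
          Complex.ofRealCLM.hasFDerivAt.comp z (hχ.differentiable one_ne_zero z).hasFDerivAt
        exact (ha.mul (hfS z hSz).differentiableAt.hasDerivAt.complexToReal_fderiv).sub
          (hPz z hSz).differentiableAt.hasDerivAt.complexToReal_fderiv
      rw [dbarTwist, (hnz z hSz).fderiv_eq, h1.fderiv]
      simp
      ring

/-! ### Convergence of the interpolation series -/

lemma rpow_le_of_mem_Icc {y p : ℝ} (h1 : 1 / 4 ≤ y) (h2 : y ≤ 4) : y ^ p ≤ 4 ^ |p| := by
  have hy : 0 < y := by linarith
  rcases le_or_gt 0 p with hp | hp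
  · rw [abs_of_nonneg hp]; gcongr
  · rw [abs_of_neg hp, Real.rpow_neg (by norm_num), ← Real.inv_rpow (by norm_num)]
    exact Real.rpow_le_rpow_of_nonpos (by norm_num) (by linarith) hp.le

/-- The weighted `L²`-mass of `f` on `{z | R ≤ |z|}`. -/
noncomputable def fockTail (φ : ℝ → ℝ) (f : ℂ → ℂ) (R : ℝ) : ℝ≥0∞ :=
  ∫⁻ z in {z : ℂ | R ≤ ‖z‖}, ENNReal.ofReal (‖f z‖ ^ 2 * Real.exp (-2 * φ ‖z‖))

lemma fockTail_eq_indicator (φ : ℝ → ℝ) (f : ℂ → ℂ) (R : ℝ) :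
    fockTail φ f R = ∫⁻ z, Set.indicator {z : ℂ | R ≤ ‖z‖}
      (fun z => ENNReal.ofReal (‖f z‖ ^ 2 * Real.exp (-2 * φ ‖z‖))) z :=
  (lintegral_indicator (measurableSet_le measurable_const measurable_norm) _).symm

lemma measurable_fockDensity {φ : ℝ → ℝ} (hφ : IsFockWeight φ) {f : ℂ → ℂ}
    (hf : Differentiable ℂ f) :
    Measurable fun z => ENNReal.ofReal (‖f z‖ ^ 2 * Real.exp (-2 * φ ‖z‖)) := by
  have h1 : Measurable f := hf.continuous.measurable
  have h2 : Measurable fun z : ℂ => φ ‖z‖ := hφ.contDiff.continuous.measurable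
  exact ((h1.norm.pow_const 2).mul
    (Real.measurable_exp.comp (h2.const_mul (-2)))).ennreal_ofReal

lemma tendsto_fockTail {φ : ℝ → ℝ} (hφ : IsFockWeight φ) {f : ℂ → ℂ} (hf : f ∈ FockSpace φ) :
    Tendsto (fockTail φ f) atTop (𝓝 0) := by
  have hm := measurable_fockDensity hφ hf.1
  have hfin : ∫⁻ z, ENNReal.ofReal (‖f z‖ ^ 2 * Real.exp (-2 * φ ‖z‖)) ≠ ∞ := by
    intro h
    have := hf.2
    rw [fockNorm, h] at this
    simp at this
  have h := tendsto_lintegral_filter_of_dominated_convergence (μ := volume) (l := atTop)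
    (F := fun R : ℝ => Set.indicator {z : ℂ | R ≤ ‖z‖}
      (fun z => ENNReal.ofReal (‖f z‖ ^ 2 * Real.exp (-2 * φ ‖z‖)))) (f := fun _ => 0)
    (fun z => ENNReal.ofReal (‖f z‖ ^ 2 * Real.exp (-2 * φ ‖z‖)))
    (Eventually.of_forall fun R =>
      hm.indicator (measurableSet_le measurable_const measurable_norm))
    (Eventually.of_forall fun R => Eventually.of_forall fun z => Set.indicator_le_self _ _ _)
    hfin (Eventually.of_forall fun z => by
      refine tendsto_const_nhds.congr' ?_
      filter_upwards [eventually_gt_atTop ‖z‖] with R hR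
      rw [Set.indicator_of_notMem]
      simpa using hR)
  rw [funext (fockTail_eq_indicator φ f)]
  simpa only [lintegral_zero] using h

lemma exp_modifiedWeight {φ : ℝ → ℝ} {β r : ℝ} (hr : 0 ≤ r) :
    Real.exp (-2 * modifiedWeight φ β r) = Real.exp (-2 * φ r) * (1 + r) ^ (-2 * β) := by
  rw [modifiedWeight, Real.rpow_def_of_pos (by linarith), ← Real.exp_add]
  congr 1; ring

/-- The upper bound for `|S|`, with the distance to the zeros bounded by a multiple of `ρ`. -/
lemma InClassS.exists_sq_mul_exp_le {φ : ℝ → ℝ} {γ : ℝ} {S : ℂ → ℂ} (hφ : IsFockWeight φ)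
    (hS : InClassS φ γ S) (hne : (zeroSet S).Nonempty) (β : ℝ) :
    ∃ C : ℝ, 0 < C ∧ ∀ z, ‖S z‖ ^ 2 * Real.exp (-2 * modifiedWeight φ β ‖z‖) ≤
      C * (1 + ‖z‖) ^ (-2 * (γ + β)) := by
  obtain ⟨M, hM, hcmp⟩ := hS.comparable
  obtain ⟨D, hD, hdist⟩ := hS.exists_infDist_le hφ hne
  refine ⟨(M * D) ^ 2, by positivity, fun z => ?_⟩
  have hρ := hφ.rho_pos z
  have hz : 0 < 1 + ‖z‖ := by positivity
  have h1 : ‖S z‖ ≤ M * D * (Real.exp (φ ‖z‖) * (1 + ‖z‖) ^ (-γ)) := by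
    refine (hcmp z trivial).1.trans ?_
    rw [Real.rpow_neg hz.le]
    have h2 : Metric.infDist z (zeroSet S) / rho φ z ≤ D := by
      rw [div_le_iff₀ hρ]; exact hdist z
    calc M * (Real.exp (φ ‖z‖) * (Metric.infDist z (zeroSet S) / rho φ z) * (1 / (1 + ‖z‖) ^ γ)) ≤
        M * (Real.exp (φ ‖z‖) * D * (1 / (1 + ‖z‖) ^ γ)) := by gcongr
      _ = _ := by ring
  rw [exp_modifiedWeight (norm_nonneg z)]
  calc _ ≤ (M * D * (Real.exp (φ ‖z‖) * (1 + ‖z‖) ^ (-γ))) ^ 2 *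
        (Real.exp (-2 * φ ‖z‖) * (1 + ‖z‖) ^ (-2 * β)) := by gcongr
    _ = (M * D) ^ 2 * ((Real.exp (φ ‖z‖) * Real.exp (φ ‖z‖) * Real.exp (-2 * φ ‖z‖)) *
        ((1 + ‖z‖) ^ (-γ) * (1 + ‖z‖) ^ (-γ) * (1 + ‖z‖) ^ (-2 * β))) := by ring
    _ = _ := by
        rw [← Real.exp_add, ← Real.exp_add, ← Real.rpow_add hz, ← Real.rpow_add hz]
        have e1 : φ ‖z‖ + φ ‖z‖ + -2 * φ ‖z‖ = 0 := by ring
        have e2 : -γ + -γ + -2 * β = -2 * (γ + β) := by ring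
        rw [e1, e2, Real.exp_zero, one_mul]

/-- The lower bound for `|S|` at points whose distance to the zeros is at least `κ ρ`. -/
lemma InClassS.exists_norm_div_sq_le {φ : ℝ → ℝ} {γ : ℝ} {S : ℂ → ℂ} (hφ : IsFockWeight φ)
    (hS : InClassS φ γ S) : ∃ C : ℝ, 0 < C ∧ ∀ (z w : ℂ) (κ : ℝ), 0 < κ →
      κ * rho φ z ≤ Metric.infDist z (zeroSet S) →
      ‖w / S z‖ ^ 2 ≤ C / κ ^ 2 * (1 + ‖z‖) ^ (2 * γ) * (‖w‖ ^ 2 * Real.exp (-2 * φ ‖z‖)) := by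
  obtain ⟨M, hM, hcmp⟩ := hS.comparable
  refine ⟨M ^ 2, by positivity, fun z w κ hκ hd => ?_⟩
  have hρ := hφ.rho_pos z
  have hz : 0 < 1 + ‖z‖ := by positivity
  have hγ : 0 < (1 + ‖z‖) ^ γ := by positivity
  have h2 : κ ≤ Metric.infDist z (zeroSet S) / rho φ z := by rwa [le_div_iff₀ hρ]
  have h1 : Real.exp (φ ‖z‖) * κ * (1 / (1 + ‖z‖) ^ γ) ≤ M * ‖S z‖ := by
    refine le_trans ?_ (hcmp z trivial).2
    simp only
    gcongr
  have hS0 : 0 < ‖S z‖ := by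
    have : 0 < M * ‖S z‖ := lt_of_lt_of_le (by positivity) h1
    exact pos_of_mul_pos_right this hM.le
  have h3 : ‖w / S z‖ ≤ M / κ * (1 + ‖z‖) ^ γ * (‖w‖ * Real.exp (-φ ‖z‖)) := by
    rw [norm_div, div_le_iff₀ hS0, Real.exp_neg]
    have h4 : 1 ≤ M / κ * (1 + ‖z‖) ^ γ * (Real.exp (φ ‖z‖))⁻¹ * ‖S z‖ := by
      have : Real.exp (φ ‖z‖) * κ * (1 / (1 + ‖z‖) ^ γ) * ((1 + ‖z‖) ^ γ * (Real.exp (φ ‖z‖))⁻¹ / κ)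
          ≤ M * ‖S z‖ * ((1 + ‖z‖) ^ γ * (Real.exp (φ ‖z‖))⁻¹ / κ) := by gcongr
      calc (1 : ℝ) = Real.exp (φ ‖z‖) * κ * (1 / (1 + ‖z‖) ^ γ) *
            ((1 + ‖z‖) ^ γ * (Real.exp (φ ‖z‖))⁻¹ / κ) := by
              have := Real.exp_pos (φ ‖z‖)
              field_simp
        _ ≤ _ := this
        _ = _ := by ring
    calc ‖w‖ = ‖w‖ * 1 := (mul_one _).symm
      _ ≤ ‖w‖ * (M / κ * (1 + ‖z‖) ^ γ * (Real.exp (φ ‖z‖))⁻¹ * ‖S z‖) := by gcongr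
      _ = _ := by ring
  calc _ ≤ (M / κ * (1 + ‖z‖) ^ γ * (‖w‖ * Real.exp (-φ ‖z‖))) ^ 2 := by gcongr
    _ = M ^ 2 / κ ^ 2 * ((1 + ‖z‖) ^ γ * (1 + ‖z‖) ^ γ) *
        (‖w‖ ^ 2 * (Real.exp (-φ ‖z‖) * Real.exp (-φ ‖z‖))) := by ring
    _ = _ := by
        rw [← Real.rpow_add hz, ← Real.exp_add]
        ring_nf

/-- Cutoffs that single out the first `N` zeros: the transition takes place in an annulus of width
comparable to `ρ` around the circle through `lam N`, at distance at least `κ ρ` from all zeros. -/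
lemma InClassS.exists_adapted_cutoff {φ : ℝ → ℝ} {γ : ℝ} {S : ℂ → ℂ} (hφ : IsFockWeight φ)
    (hS : InClassS φ γ S) {lam : ℕ → ℂ} (hlam : IsOrderedEnumeration (zeroSet S) lam) :
    ∃ ε κ B : ℝ, 0 < ε ∧ 0 < κ ∧ 0 < B ∧ ∀ N, 1 ≤ ‖lam N‖ →
      ∃ (χ : ℂ → ℝ) (δ : ℝ), 0 < δ ∧ ContDiff ℝ 1 χ ∧ (∀ z, 0 ≤ χ z ∧ χ z ≤ 1) ∧
        (∀ z, ‖z‖ ≤ ‖lam N‖ / 2 → χ z = 1) ∧ (∀ z, 2 * ‖lam N‖ ≤ ‖z‖ → χ z = 0) ∧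
        (∀ k, ∀ z ∈ Metric.ball (lam k) δ, χ z = if k < N then 1 else 0) ∧
        (∀ z, ‖fderiv ℝ χ z‖ ≤ B / rho φ (lam N)) ∧
        ∃ a b : ℝ, ‖lam N‖ / 2 ≤ a ∧ a ≤ b ∧ b ≤ 2 * ‖lam N‖ ∧ b - a ≤ ε * rho φ (lam N) ∧
          ∀ z, fderiv ℝ χ z ≠ 0 → ‖z‖ ∈ Set.Icc a b ∧
            κ * rho φ z ≤ Metric.infDist z (zeroSet S) := by
  obtain ⟨c, K, hc, hK, hcomp, hlin⟩ := hφ.exists_rho_bounds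
  obtain ⟨s, hs, hsep⟩ := hS.separated
  obtain ⟨B, hB, hcut⟩ := exists_cutoff
  have hρ0 := hφ.rho_pos 0
  set L := K * rho φ 0 + 1 / c with hL
  have hL0 : 0 < L := by positivity
  set ε := min (c / 2) (1 / (4 * L)) with hε
  have hε0 : 0 < ε := by positivity
  set δ₀ := min (ε / 4) (s / (6 * K)) with hδ₀
  have hδ₀0 : 0 < δ₀ := by positivity
  refine ⟨2 * ε, δ₀ / K, B / δ₀, by positivity, by positivity, by positivity, fun N hN => ?_⟩
  set R := ‖lam N‖ with hR
  set ρ := rho φ (lam N) with hρdef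
  have hρ : 0 < ρ := hφ.rho_pos _
  have hρR : ρ ≤ L * R := by
    have h1 := hlin 0 (lam N)
    rw [norm_zero, sub_zero, abs_norm, ← hR] at h1
    calc ρ ≤ K * rho φ 0 + R / c := h1
      _ ≤ K * rho φ 0 * R + R / c := by
          have : K * rho φ 0 ≤ K * rho φ 0 * R := le_mul_of_one_le_right (by positivity) hN
          linarith
      _ = L * R := by rw [hL]; ring
  set w := ε * ρ with hw
  have hw0 : 0 < w := by positivity
  have hw1 : 2 * w ≤ c * ρ := by
    have : ε ≤ c / 2 := min_le_left _ _
    rw [hw]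
    nlinarith
  have hw2 : w ≤ R / 4 := by
    calc w ≤ 1 / (4 * L) * (L * R) := by rw [hw]; gcongr; exact min_le_right _ _
      _ = R / 4 := by field_simp
  set δ := δ₀ * ρ with hδ
  have hδ0 : 0 < δ := by positivity
  have hδw : 4 * δ ≤ w := by
    have : δ₀ ≤ ε / 4 := min_le_left _ _
    rw [hδ, hw]
    nlinarith
  have hann : ∀ z : ℂ, ‖z‖ ∈ Set.Icc (R - w) (R + 2 * w) → rho φ z ≤ K * ρ ∧ ρ ≤ K * rho φ z := by
    intro z hz
    refine hcomp (lam N) z (abs_le.2 ⟨?_, ?_⟩)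
    · linarith [hz.1]
    · linarith [hz.2]
  have hmem : ∀ k, lam k ∈ zeroSet S := fun k => hlam.range_eq ▸ Set.mem_range_self k
  classical
  set cv : ℂ → ℝ := fun l => if ∃ k < N, lam k = l then 1 else 0 with hcv
  have hcvk : ∀ k, cv (lam k) = if k < N then 1 else 0 := by
    intro k
    simp only [hcv]
    congr 1
    simp [hlam.injective.eq_iff]
  obtain ⟨χ, hχd, hχ01, hχ1, hχ0, hχl, hχf⟩ := hcut R w δ (zeroSet S) cv (by positivity) hδ0 hδw
    (finite_zeroSet_inter_closedBall hS.entire hlam.countable _)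
    (fun z hz z' hz' hne ha ha' => by
      have h1 := hsep z hz z' hz' hne
      have hm : 0 < min (rho φ z) (rho φ z') := lt_min (hφ.rho_pos _) (hφ.rho_pos _)
      rw [dRho, le_div_iff₀ hm] at h1
      have h2 : ρ / K ≤ min (rho φ z) (rho φ z') := by
        refine le_min ?_ ?_
        · rw [div_le_iff₀ (by positivity), mul_comm]; exact (hann z ha).2
        · rw [div_le_iff₀ (by positivity), mul_comm]; exact (hann z' ha').2
      have h3 : δ₀ ≤ s / (6 * K) := min_le_right _ _
      calc 6 * δ ≤ 6 * (s / (6 * K) * ρ) := by rw [hδ]; gcongr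
        _ = s * (ρ / K) := by field_simp
        _ ≤ _ := (mul_le_mul_of_nonneg_left h2 hs.le).trans h1)
    (fun z hz => by
      -- several zeros may lie on the circle `|z| = R`, on either side of the index `N`
      rw [← hlam.range_eq] at hz
      obtain ⟨k, rfl⟩ := hz
      rw [hcvk k]
      by_cases hk : k < N
      · exact Or.inl ⟨if_pos hk, hlam.monotone_norm hk.le⟩
      · exact Or.inr ⟨if_neg hk, hlam.monotone_norm (not_lt.1 hk)⟩)
  refine ⟨χ, δ, hδ0, hχd, hχ01, fun z hz => hχ1 z (by linarith), fun z hz => hχ0 z (by linarith),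
    fun k z hz => (hχl _ (hmem k) z hz).trans (hcvk k), fun z => ?_,
    R - 2 * δ, R + w, by linarith, by linarith, by linarith, by linarith, fun z hz => ?_⟩
  · refine (hχf z).trans_eq ?_
    rw [hδ, div_div]
  · have hconst : ∀ C : ℝ, ¬ χ =ᶠ[𝓝 z] fun _ => C := by
      intro C hC
      apply hz
      rw [hC.fderiv_eq]
      simp
    have hcont : ContinuousAt (fun z : ℂ => ‖z‖) z := by fun_prop
    have hza : R - 2 * δ ≤ ‖z‖ := by
      by_contra! h
      refine hconst 1 ?_
      filter_upwards [hcont.eventually (gt_mem_nhds h)] with y hy using hχ1 y hy.le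
    have hzb : ‖z‖ ≤ R + w := by
      by_contra! h
      refine hconst 0 ?_
      filter_upwards [hcont.eventually (lt_mem_nhds h)] with y hy using hχ0 y hy.le
    refine ⟨⟨hza, hzb⟩, ?_⟩
    have h1 := (hann z ⟨by linarith, by linarith⟩).1
    have h2 : δ₀ / K * rho φ z ≤ δ := by
      calc δ₀ / K * rho φ z ≤ δ₀ / K * (K * ρ) := by gcongr
        _ = δ := by rw [hδ]; field_simp
    refine h2.trans ?_
    rw [Metric.le_infDist ⟨lam 0, hmem 0⟩]
    intro l hl
    by_contra! h
    refine hconst (cv l) ?_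
    filter_upwards [Metric.isOpen_ball.mem_nhds (show z ∈ Metric.ball l δ from h)] with y hy
      using hχl l hl y hy

/-- The squared norm of the remainder is bounded by the tail of `f`. With `R = |λ_N|` and
`ρ = ρ(R)`, the `∂̄`-estimate contributes `R ^ (2 - 2(γ + β))` from the weight, `ρ / R` from the
relative width of the annulus, `ρ⁻²` from the derivative of the cutoff and `R ^ (2γ)` from `1 / S`.
The product is `R ^ (1 - 2β) / ρ`, which is bounded by hypothesis. -/
theorem InClassS.exists_lintegral_remainder_le {φ : ℝ → ℝ} (hφ : IsFockWeight φ) {β γ : ℝ}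
    (hβ : 0 ≤ β) (hσ0 : 0 < γ + β) (hσ1 : γ + β < 1) {S : ℂ → ℂ} (hS : InClassS φ γ S)
    {lam : ℕ → ℂ} (hlam : IsOrderedEnumeration (zeroSet S) lam)
    (hρ : (fun r : ℝ => r ^ (1 - 2 * β)) =O[atTop] (fun r : ℝ => rho φ (r : ℂ)))
    {f : ℂ → ℂ} (hf : Differentiable ℂ f) :
    ∃ C : ℝ, ∀ᶠ N in atTop, ∫⁻ z : ℂ, ENNReal.ofReal (‖f z - lagrangePartialSum S lam f N z‖ ^ 2 *
      Real.exp (-2 * modifiedWeight φ β ‖z‖)) ≤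
        ENNReal.ofReal C * fockTail φ f (‖lam N‖ / 2) := by
  have hmem : ∀ k, lam k ∈ zeroSet S := fun k => hlam.range_eq ▸ Set.mem_range_self k
  set σ := γ + β with hσ
  obtain ⟨C₁, hC₁, hSup⟩ := hS.exists_sq_mul_exp_le hφ ⟨lam 0, hmem 0⟩ β
  obtain ⟨C₂, hC₂, hdiv⟩ := hS.exists_norm_div_sq_le hφ
  obtain ⟨ε, κ, B, hε, hκ, hB, hcut⟩ := hS.exists_adapted_cutoff hφ hlam
  obtain ⟨A, hA, hAρ⟩ := hρ.exists_pos
  have hnorm := hlam.tendsto_norm hS.entire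
  set Cσ := 1 / (2 - 2 * σ) + 1 / (2 * σ) with hCσ
  have h2σ : 0 < 2 - 2 * σ := by linarith
  have hCσ0 : 0 < Cσ := by positivity
  set C₃ := Cσ * 2 ^ (2 - 2 * σ) * (2 * ε) * (4 * B ^ 2 * (C₂ / κ ^ 2) * 4 ^ |2 * γ|) * A with hC₃
  refine ⟨2 + 2 * C₁ * C₃, ?_⟩
  filter_upwards [hnorm.eventually hAρ.bound, hnorm.eventually (eventually_ge_atTop 1)]
    with N hN1 hN2
  obtain ⟨χ, δ, hδ, hχd, hχ01, hχ1, hχ0, hχl, hχf, a, b, haR, hab, hbR, hba, hsupp⟩ := hcut N hN2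
  obtain ⟨G, hGd, hGinf, hGeq, hGdbar⟩ := exists_remainder hS.entire hf hlam
    (fun l hl => hS.deriv_ne_zero hφ hlam.countable hl) N hχd hδ hχl hχ0
  set R := ‖lam N‖ with hR
  set ρ := rho φ (lam N) with hρdef
  have hR0 : 0 < R := by linarith
  have hρ0 : 0 < ρ := hφ.rho_pos _
  have ha0 : 0 < a := by linarith
  have hb0 : 0 < b := by linarith
  have hscale : R ^ (1 - 2 * β) ≤ A * ρ := by
    have h1 : rho φ ((R : ℝ) : ℂ) = ρ := (hφ.rho_eq_norm (lam N)).symm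
    rw [h1, Real.norm_of_nonneg (by positivity), Real.norm_of_nonneg hρ0.le] at hN1
    exact hN1
  set F : ℂ → ℝ≥0∞ := Set.indicator {z : ℂ | R / 2 ≤ ‖z‖}
      (fun z => ENNReal.ofReal (‖f z‖ ^ 2 * Real.exp (-2 * φ ‖z‖))) with hF
  have hFm : Measurable F :=
    (measurable_fockDensity hφ hf).indicator (measurableSet_le measurable_const measurable_norm)
  have hFin : ∀ z : ℂ, R / 2 ≤ ‖z‖ →
      F z = ENNReal.ofReal (‖f z‖ ^ 2 * Real.exp (-2 * φ ‖z‖)) := fun z hz =>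
    Set.indicator_of_mem (s := {z : ℂ | R / 2 ≤ ‖z‖}) hz _
  have hFtail : ∫⁻ z, F z = fockTail φ f (R / 2) := (fockTail_eq_indicator φ f (R / 2)).symm
  have hdbar : ∀ z, ENNReal.ofReal ((‖dbarTwist G z‖ / ‖z‖) ^ 2) ≤
      ENNReal.ofReal (4 * B ^ 2 * (C₂ / κ ^ 2) * 4 ^ |2 * γ| * (R ^ (2 * γ) / ρ ^ 2)) * F z := by
    intro z
    by_cases hz : fderiv ℝ χ z = 0
    · rw [hGdbar z, hz]
      simp
    obtain ⟨hzab, hzd⟩ := hsupp z hz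
    have hz0 : 0 < ‖z‖ := ha0.trans_le hzab.1
    rw [hFin z (haR.trans hzab.1), ← ENNReal.ofReal_mul (by positivity)]
    refine ENNReal.ofReal_le_ofReal ?_
    have h1 : ‖dbarTwist G z‖ / ‖z‖ ≤ 2 * (B / ρ) * ‖f z / S z‖ := by
      rw [div_le_iff₀ hz0, hGdbar z, norm_mul]
      have h2 : ‖(fderiv ℝ χ z z : ℂ)‖ ≤ B / ρ * ‖z‖ := by
        rw [Complex.norm_real]
        exact ((fderiv ℝ χ z).le_opNorm z).trans (by gcongr; exact hχf z)
      have h3 : ‖(fderiv ℝ χ z (Complex.I * z) : ℂ)‖ ≤ B / ρ * ‖z‖ := by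
        rw [Complex.norm_real]
        refine ((fderiv ℝ χ z).le_opNorm _).trans ?_
        rw [norm_mul, Complex.norm_I, one_mul]
        gcongr
        exact hχf z
      calc _ ≤ ‖f z / S z‖ * (B / ρ * ‖z‖ + B / ρ * ‖z‖) := by
            gcongr
            refine (norm_sub_le _ _).trans (add_le_add ?_ h3)
            rw [norm_mul, Complex.norm_I, one_mul]
            exact h2
        _ = _ := by ring
    have h4 : (1 + ‖z‖) ^ (2 * γ) ≤ 4 ^ |2 * γ| * R ^ (2 * γ) := by
      have h5 : (1 + ‖z‖) ^ (2 * γ) = ((1 + ‖z‖) / R) ^ (2 * γ) * R ^ (2 * γ) := by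
        rw [← Real.mul_rpow (by positivity) hR0.le, div_mul_cancel₀ _ hR0.ne']
      rw [h5]
      gcongr
      refine rpow_le_of_mem_Icc ?_ ?_
      · rw [le_div_iff₀ hR0]; linarith [hzab.1]
      · rw [div_le_iff₀ hR0]; linarith [hzab.2]
    calc _ ≤ (2 * (B / ρ) * ‖f z / S z‖) ^ 2 := by gcongr
      _ = 4 * B ^ 2 / ρ ^ 2 * ‖f z / S z‖ ^ 2 := by ring
      _ ≤ 4 * B ^ 2 / ρ ^ 2 * (C₂ / κ ^ 2 * (4 ^ |2 * γ| * R ^ (2 * γ)) *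
          (‖f z‖ ^ 2 * Real.exp (-2 * φ ‖z‖))) := by
          gcongr
          refine (hdiv z (f z) κ hκ hzd).trans ?_
          gcongr
      _ = _ := by ring
  have hGnorm : ∫⁻ z, ENNReal.ofReal (‖G z‖ ^ 2 * (1 + ‖z‖) ^ (-2 * σ)) ≤
      ENNReal.ofReal C₃ * fockTail φ f (R / 2) := by
    have h1 := lintegral_sq_mul_weight_le hGd hGinf ha0 hab (fun z hz => by
      have : fderiv ℝ χ z = 0 := by
        by_contra h
        exact hz (hsupp z h).1
      rw [hGdbar z, this]
      simp) hσ0 hσ1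
    refine h1.trans ?_
    calc _ ≤ ENNReal.ofReal (Cσ * b ^ (2 - 2 * σ) * ((b - a) / a)) * ∫⁻ z, ENNReal.ofReal
          (4 * B ^ 2 * (C₂ / κ ^ 2) * 4 ^ |2 * γ| * (R ^ (2 * γ) / ρ ^ 2)) * F z := by
          gcongr with z
          exact hdbar z
      _ = ENNReal.ofReal (Cσ * b ^ (2 - 2 * σ) * ((b - a) / a) *
          (4 * B ^ 2 * (C₂ / κ ^ 2) * 4 ^ |2 * γ| * (R ^ (2 * γ) / ρ ^ 2))) *
          fockTail φ f (R / 2) := by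
          have : 0 ≤ b - a := sub_nonneg.2 hab
          rw [lintegral_const_mul _ hFm, hFtail, ← mul_assoc, ← ENNReal.ofReal_mul (by positivity)]
      _ ≤ _ := by
          gcongr
          have h2 : b ^ (2 - 2 * σ) ≤ 2 ^ (2 - 2 * σ) * R ^ (2 - 2 * σ) := by
            rw [← Real.mul_rpow two_pos.le hR0.le]
            gcongr
          have h3 : (b - a) / a ≤ 2 * ε * (ρ / R) := by
            calc (b - a) / a ≤ ε * ρ / (R / 2) := by
                  have : 0 ≤ b - a := sub_nonneg.2 hab
                  gcongr
              _ = _ := by field_simp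
          have h4 : 0 ≤ (b - a) / a := div_nonneg (sub_nonneg.2 hab) ha0.le
          calc _ ≤ Cσ * (2 ^ (2 - 2 * σ) * R ^ (2 - 2 * σ)) * (2 * ε * (ρ / R)) *
                (4 * B ^ 2 * (C₂ / κ ^ 2) * 4 ^ |2 * γ| * (R ^ (2 * γ) / ρ ^ 2)) := by gcongr
            _ = Cσ * 2 ^ (2 - 2 * σ) * (2 * ε) * (4 * B ^ 2 * (C₂ / κ ^ 2) * 4 ^ |2 * γ|) *
                (R ^ (2 - 2 * σ) * R ^ (2 * γ) / R / ρ) := by field_simp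
            _ = Cσ * 2 ^ (2 - 2 * σ) * (2 * ε) * (4 * B ^ 2 * (C₂ / κ ^ 2) * 4 ^ |2 * γ|) *
                (R ^ (1 - 2 * β) / ρ) := by
                rw [← Real.rpow_add hR0, ← Real.rpow_sub_one hR0.ne']
                congr 3
                rw [hσ]; ring
            _ ≤ _ := by
                rw [hC₃]
                gcongr
                rw [div_le_iff₀ hρ0]
                exact hscale
  have hae : ∀ᵐ z : ℂ, S z ≠ 0 := hlam.countable.ae_notMem volume
  calc _ ≤ ∫⁻ z, (2 * F z + ENNReal.ofReal (2 * C₁) *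
        ENNReal.ofReal (‖G z‖ ^ 2 * (1 + ‖z‖) ^ (-2 * σ))) := by
        refine lintegral_mono_ae ?_
        filter_upwards [hae] with z hz
        have hχz := hχ01 z
        have hw : Real.exp (-2 * modifiedWeight φ β ‖z‖) ≤ Real.exp (-2 * φ ‖z‖) := by
          rw [exp_modifiedWeight (norm_nonneg z)]
          refine mul_le_of_le_one_right (Real.exp_pos _).le ?_
          exact Real.rpow_le_one_of_one_le_of_nonpos (by linarith [norm_nonneg z]) (by linarith)
        have hsq : ‖f z - lagrangePartialSum S lam f N z‖ ^ 2 ≤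
            2 * ((1 - χ z) * ‖f z‖) ^ 2 + 2 * (‖S z‖ * ‖G z‖) ^ 2 := by
          have h1 : ‖f z - lagrangePartialSum S lam f N z‖ ≤
              (1 - χ z) * ‖f z‖ + ‖S z‖ * ‖G z‖ := by
            rw [hGeq z hz]
            refine (norm_add_le _ _).trans_eq ?_
            rw [norm_mul, norm_mul, ← Complex.ofReal_one, ← Complex.ofReal_sub, Complex.norm_real,
              Real.norm_of_nonneg (by linarith)]
          calc _ ≤ ((1 - χ z) * ‖f z‖ + ‖S z‖ * ‖G z‖) ^ 2 := by gcongr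
            _ ≤ _ := by nlinarith [sq_nonneg ((1 - χ z) * ‖f z‖ - ‖S z‖ * ‖G z‖)]
        have h1 : ENNReal.ofReal (2 * ((1 - χ z) * ‖f z‖) ^ 2 *
            Real.exp (-2 * modifiedWeight φ β ‖z‖)) ≤ 2 * F z := by
          rcases le_or_gt (R / 2) ‖z‖ with hzR | hzR
          · rw [hFin z hzR, ← ENNReal.ofReal_ofNat 2, ← ENNReal.ofReal_mul two_pos.le]
            refine ENNReal.ofReal_le_ofReal ?_
            have h2 : ((1 - χ z) * ‖f z‖) ^ 2 ≤ ‖f z‖ ^ 2 := by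
              have h3 : (1 - χ z) * ‖f z‖ ≤ ‖f z‖ :=
                mul_le_of_le_one_left (norm_nonneg _) (by linarith)
              have h4 : 0 ≤ (1 - χ z) * ‖f z‖ := mul_nonneg (by linarith) (norm_nonneg _)
              gcongr
            rw [mul_assoc]
            gcongr
          · rw [hχ1 z hzR.le]
            simp
        have h2 : ENNReal.ofReal (2 * (‖S z‖ * ‖G z‖) ^ 2 *
            Real.exp (-2 * modifiedWeight φ β ‖z‖)) ≤ ENNReal.ofReal (2 * C₁) *
            ENNReal.ofReal (‖G z‖ ^ 2 * (1 + ‖z‖) ^ (-2 * σ)) := by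
          rw [← ENNReal.ofReal_mul (by positivity)]
          refine ENNReal.ofReal_le_ofReal ?_
          calc _ = 2 * ‖G z‖ ^ 2 * (‖S z‖ ^ 2 * Real.exp (-2 * modifiedWeight φ β ‖z‖)) := by ring
            _ ≤ 2 * ‖G z‖ ^ 2 * (C₁ * (1 + ‖z‖) ^ (-2 * σ)) :=
                mul_le_mul_of_nonneg_left (hSup z) (by positivity)
            _ = _ := by ring
        refine le_trans ?_ (add_le_add h1 h2)
        rw [← ENNReal.ofReal_add (by positivity) (by positivity), ← add_mul]
        refine ENNReal.ofReal_le_ofReal ?_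
        gcongr
    _ ≤ 2 * fockTail φ f (R / 2) +
        ENNReal.ofReal (2 * C₁) * (ENNReal.ofReal C₃ * fockTail φ f (R / 2)) := by
        rw [lintegral_add_left (hFm.const_mul 2), lintegral_const_mul _ hFm, hFtail,
          lintegral_const_mul' _ _ ENNReal.ofReal_ne_top]
        gcongr
    _ = _ := by
        rw [ENNReal.ofReal_add two_pos.le (by positivity), add_mul, ENNReal.ofReal_ofNat,
          ENNReal.ofReal_mul (by positivity : 0 ≤ 2 * C₁), mul_assoc]

theorem theorem2 (φ : ℝ → ℝ) (hφ : IsFockWeight φ)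
    (β γ : ℝ) (hβ₀ : 0 ≤ β) (hβ₁ : β ≤ 1) (hγβ : γ + β ∈ Set.Ioo (1 / 2 : ℝ) 1)
    (S : ℂ → ℂ) (hS : InClassS φ γ S)
    (lam : ℕ → ℂ) (hlam : IsOrderedEnumeration (zeroSet S) lam)
    (hρ : (fun r : ℝ => r ^ (1 - 2 * β)) =O[atTop] (fun r : ℝ => rho φ (r : ℂ)))
    (f : ℂ → ℂ) (hf : f ∈ FockSpace φ) :
    Tendsto
      (fun N : ℕ => fockNorm (modifiedWeight φ β) (fun z => f z - lagrangePartialSum S lam f N z))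
      atTop (𝓝 0) := by
  obtain ⟨C, hC⟩ := hS.exists_lintegral_remainder_le hφ hβ₀ (by linarith [hγβ.1]) hγβ.2 hlam hρ hf.1
  have htail : Tendsto (fun N => ENNReal.ofReal C * fockTail φ f (‖lam N‖ / 2)) atTop (𝓝 0) := by
    have h1 : Tendsto (fun N => ‖lam N‖ / 2) atTop atTop :=
      (hlam.tendsto_norm hS.entire).atTop_div_const two_pos
    have h2 := ENNReal.Tendsto.const_mul ((tendsto_fockTail hφ hf).comp h1)
      (Or.inr (ENNReal.ofReal_ne_top (r := C)))
    simpa using h2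
  have hint := tendsto_of_tendsto_of_tendsto_of_le_of_le' tendsto_const_nhds htail
    (Eventually.of_forall fun _ => zero_le) hC
  have := hint.ennrpow_const (1 / 2)
  rwa [ENNReal.zero_rpow_of_pos (by norm_num)] at this
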